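/- A \emph{hypergraph} over a set $V$ of vertices and a ranked alphabet $F$ is a set of hyperarcs $f v_1\cdots v_n$ with $f\in F$ of arity $n$ and $v_1,\dots,v_n\in V$; its vertex set consists of the vertices that occur on its hyperarcs. A \emph{hypergraph grammar} is a tuple $G=(N,T,R,Z)$, where $N$ and $T=T_1\cup T_2$ are finite ranked alphabets of non-terminals and terminals, the terminals having arity one (colours, $T_1$) or two (arc labels, $T_2$), $Z\in N$ has arity $0$, and $R$ assigns to each $A\in N$ of arity $\rho(A)$ a pair $(H_A,\iota_A)$ of a finite hypergraph $H_A$ over $N\cup T$ and an injective map $\iota_A$ from $\{1,\dots,\rho(A)\}$ into the vertices of $H_A$. In a complete parallel rewriting $M\Rightarrow_R M'$ of a hypergraph $M$, all non-terminal hyperarcs $X=Av_1\cdots v_{\rho(A)}$ of $M$ are simultaneously replaced by copies $h_X(H_A)$, where $h_X$ maps $\iota_A(i)$ to $v_i$ and maps the other vertices of $H_A$ injectively to vertices outside $M$, the new vertices of different copies being different. Write $[M]$ for the set of terminal hyperarcs of $M$. The graphs generated by $G$ are the unions $\bigcup_{n\ge 0}[M_n]$ over the sequences $M_0=\{Z\}$,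 $M_n\Rightarrow_R M_{n+1}$ $(n\ge 0)$; they are all isomorphic. For a vertex $v$ of a generated graph and $a\in T_2$, let $\#(v,a)$ be the number of vertices $v'$ with an $a$-labelled arc from $v$ to $v'$. Let $\mu$ be a map from $T_2$ to $[0,1]$. The pair $(G,\mu)$ is a \emph{probabilistic hypergraph grammar} if for each vertex $v$ of a generated graph all the numbers $\#(v,a)$ are finite and $\sum_{a\in T_2}\mu(a)\,\#(v,a)=1$. \textbf{Proposition.} Given a hypergraph grammar $G$ and a map $\mu:T_2\to[0,1]$ with rational values, it is decidable whether $(G,\mu)$ is a probabilistic hypergraph grammar. More generally, suppose that the values of $\mu$ are written in any notation for real numbers in which it is decidable whether a given number lies in $[0,1]$, and whether $\sum_i n_i x_i=1$ for a given finite list of natural numbers $n_i$ and given numbers $x_i$. Then it is decidable, given $G$ and $\mu$, whether $(G,\mu)$ is a probabilistic hypergraph grammar. -/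

import Mathlib

/-- The symbols of a hypergraph grammar: non-terminals, terminals of arity two (arc labels)
and terminals of arity one (colours). All alphabets are finite, and their letters are numbered. -/
inductive HRSymbol where
  | nonterminal (A : ℕ) : HRSymbol
  | arcLabel (a : ℕ) : HRSymbol
  | colour (c : ℕ) : HRSymbol

/-- A hyperarc `f v₁ ⋯ vₙ` over the vertex set `ℕ`: a symbol and a tuple of vertices. -/
abbrev Hyperarc : Type := HRSymbol × List ℕ

/-- The vertices of a hypergraph (a set of hyperarcs) are the vertices that occur on
one of its hyperarcs. -/
def hyperVertices (H : Set Hyperarc) : Set ℕ := {v | ∃ X ∈ H, v ∈ X.2}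

/-- `[H]`: the terminal arcs and colours of `H`. -/
def terminalPart (H : Set Hyperarc) : Set Hyperarc :=
  {X | X ∈ H ∧ ∀ A, X.1 ≠ HRSymbol.nonterminal A}

/-- The image of a hyperarc under a map of vertices. -/
def Hyperarc.mapVertices (h : ℕ → ℕ) (X : Hyperarc) : Hyperarc := (X.1, X.2.map h)

/-- The finite data of a hypergraph grammar `(N, T, R, Z)`.
* `N = {0, …, rules.length - 1}`, and entry number `A` of `rules` is the rule `(H_A, ι_A)`:
  a list of the hyperarcs of `H_A`, and the list `ι_A(1), …, ι_A(ρ(A))`;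
* `T₂ = {0, …, arcLabels - 1}` and `T₁ = {0, …, colours - 1}`;
* `start` is the non-terminal `Z`.

The conditions that these data have to satisfy are in `HRGrammar.IsValid`. -/
structure HRGrammar where
  rules : List (List Hyperarc × List ℕ)
  arcLabels : ℕ
  colours : ℕ
  start : ℕ

namespace HRGrammar

/-- The right-hand side `H_A`, a finite set of hyperarcs. -/
def rhs (G : HRGrammar) (A : ℕ) : Set Hyperarc :=
  {X | X ∈ (G.rules.getD A ([], [])).1}

/-- The tuple `ι_A(1), …, ι_A(ρ(A))` of inputs of `H_A`. -/
def inputs (G : HRGrammar) (A : ℕ) : List ℕ := (G.rules.getD A ([], [])).2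

/-- The arity `ρ(A)` of the non-terminal `A`. -/
def arity (G : HRGrammar) (A : ℕ) : ℕ := (G.inputs A).length

/-- The vertices of `H_A` that are not inputs. -/
def innerVertices (G : HRGrammar) (A : ℕ) : Set ℕ :=
  {w | w ∈ hyperVertices (G.rhs A) ∧ w ∉ G.inputs A}

/-- The label of the hyperarc is a symbol of `G`, and the number of vertices is its arity. -/
def IsHyperarc (G : HRGrammar) (X : Hyperarc) : Prop :=
  match X.1 with
  | HRSymbol.nonterminal B => B < G.rules.length ∧ X.2.length = G.arity B
  | HRSymbol.arcLabel a => a < G.arcLabels ∧ X.2.length = 2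
  | HRSymbol.colour c => c < G.colours ∧ X.2.length = 1

/-- The data are those of a hypergraph grammar: `Z` is a non-terminal of arity `0`, each `H_A` is a
hypergraph over `N ∪ T`, and each `ι_A` is injective with values in the vertices of `H_A`. -/
structure IsValid (G : HRGrammar) : Prop where
  start_mem : G.start < G.rules.length
  start_arity : G.arity G.start = 0
  rhs_isHyperarc : ∀ A < G.rules.length, ∀ X ∈ G.rhs A, G.IsHyperarc X
  inputs_injective : ∀ A < G.rules.length, (G.inputs A).Nodup
  inputs_mem : ∀ A < G.rules.length, ∀ v ∈ G.inputs A, v ∈ hyperVertices (G.rhs A)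

/-- `h` is a map along which the hyperarc `A v₁ ⋯ vₚ` of `M` may be replaced by `h(H_A)`:
it maps `ι_A(i)` to `vᵢ`, and maps the other vertices of `H_A` injectively to vertices outside `M`.
If the `vᵢ` are distinct, this says that `h` is injective on all the vertices of `H_A`. -/
structure IsReplacement (G : HRGrammar) (M : Set Hyperarc) (A : ℕ) (vs : List ℕ)
    (h : ℕ → ℕ) : Prop where
  map_inputs : (G.inputs A).map h = vs
  injOn : Set.InjOn h (G.innerVertices A)
  fresh : ∀ w ∈ G.innerVertices A, h w ∉ hyperVertices M

/-- Complete parallel rewriting: all non-terminal hyperarcs `A vs` of `M` are replaced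
simultaneously, each one by a copy `h A vs (H_A)` of its right-hand side; the new vertices of
different copies are different. -/
def ParallelRewrites (G : HRGrammar) (M M' : Set Hyperarc) : Prop :=
  ∃ h : ℕ → List ℕ → ℕ → ℕ,
    (∀ A vs, (HRSymbol.nonterminal A, vs) ∈ M → G.IsReplacement M A vs (h A vs)) ∧
    (∀ A vs B ws, (HRSymbol.nonterminal A, vs) ∈ M → (HRSymbol.nonterminal B, ws) ∈ M →
      (A, vs) ≠ (B, ws) →
      Disjoint (h A vs '' G.innerVertices A) (h B ws '' G.innerVertices B)) ∧
    M' = terminalPart M ∪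
      {Y | ∃ A vs, (HRSymbol.nonterminal A, vs) ∈ M ∧
        ∃ X ∈ G.rhs A, Y = Hyperarc.mapVertices (h A vs) X}

/-- The set `G^ω` of the graphs generated by `G`: the unions of the terminal parts along
the infinite sequences of complete parallel rewritings that start with the hyperarc `Z`. -/
def generatedGraphs (G : HRGrammar) : Set (Set Hyperarc) :=
  {H | ∃ M : ℕ → Set Hyperarc, M 0 = {(HRSymbol.nonterminal G.start, [])} ∧
    (∀ n, G.ParallelRewrites (M n) (M (n + 1))) ∧ H = ⋃ n, terminalPart (M n)}

end HRGrammar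

/-- The targets of the `a`-labelled arcs from `v` in the graph `H`. -/
def arcTargets (H : Set Hyperarc) (v a : ℕ) : Set ℕ :=
  {v' | (HRSymbol.arcLabel a, [v, v']) ∈ H}

/-- `(G, μ)` is a probabilistic hypergraph grammar: `G` is a hypergraph grammar, `μ` maps the
arc labels to `[0, 1]`, and at each vertex `v` of a generated graph the numbers `#(v, a)` of
outgoing `a`-labelled arcs are finite and satisfy `∑ a, μ(a) #(v, a) = 1`. -/
structure HRGrammar.IsProbabilistic (G : HRGrammar) (μ : Fin G.arcLabels → ℝ) : Prop where
  valid : G.IsValid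
  weight_mem : ∀ a, μ a ∈ Set.Icc (0 : ℝ) 1
  finite_arcs : ∀ H ∈ G.generatedGraphs, ∀ v ∈ hyperVertices H, ∀ a : Fin G.arcLabels,
    (arcTargets H v a).Finite
  sum_eq_one : ∀ H ∈ G.generatedGraphs, ∀ v ∈ hyperVertices H,
    ∑ a : Fin G.arcLabels, μ a * ((arcTargets H v a).ncard : ℝ) = 1

/-- The language of the decision problem. An instance is a grammar together with the list of
the weights of its arc labels, the weights being written in a notation `K` for real numbers
in which `k : K` denotes `val k`. -/
def IsPHRInstance {K : Type} (val : K → ℝ) (p : HRGrammar × List K) : Prop :=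
  ∃ hlen : p.2.length = p.1.arcLabels,
    p.1.IsProbabilistic (fun a => val (p.2.get (Fin.cast hlen.symm a)))

/-- The number denoted by a fraction: the pair `(m, d)` stands for `m / (d + 1)`. -/
noncomputable def fractionValue (q : ℕ × ℕ) : ℝ := (q.1 : ℝ) / ((q.2 : ℝ) + 1)

/-- Symbols as tagged numbers. -/
def HRSymbol.equivSum : HRSymbol ≃ ℕ ⊕ (ℕ ⊕ ℕ) where
  toFun
    | HRSymbol.nonterminal A => Sum.inl A
    | HRSymbol.arcLabel a => Sum.inr (Sum.inl a)
    | HRSymbol.colour c => Sum.inr (Sum.inr c)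
  invFun
    | Sum.inl A => HRSymbol.nonterminal A
    | Sum.inr (Sum.inl a) => HRSymbol.arcLabel a
    | Sum.inr (Sum.inr c) => HRSymbol.colour c
  left_inv x := by cases x <;> rfl
  right_inv x := by rcases x with _ | _ | _ <;> rfl

instance : Primcodable HRSymbol := Primcodable.ofEquiv _ HRSymbol.equivSum

/-- A grammar as the tuple of its fields. -/
def HRGrammar.equivProd :
    HRGrammar ≃ List (List Hyperarc × List ℕ) × ℕ × ℕ × ℕ where
  toFun G := (G.rules, G.arcLabels, G.colours, G.start)
  invFun t := ⟨t.1, t.2.1, t.2.2.1, t.2.2.2⟩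
  left_inv _ := rfl
  right_inv _ := rfl

instance : Primcodable HRGrammar := Primcodable.ofEquiv _ HRGrammar.equivProd

/-! Replacement is context-free: what grows from a hyperarc depends, up to the names of the new
vertices, only on its label and on which of its vertices coincide. An isomorphism between two
hyperarcs of a derivation therefore extends to all their descendants
(`IsDerivation.exists_extension_descendants`). Derivations may start from any hypergraph over the
grammar, so that the descendants of a single hyperarc form a derivation themselves.

Fix at most two vertices `us`. A hyperarc has one of at most `K = typeBound` types relative to `us`:
its symbol and the pattern of equalities among its vertices and `us`. Among the first `K + 1`
members of a chain of ancestors two have the same type (`exists_sameType`), and the chain can be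
pumped. Pumping down, a type that occurs among the descendants of a hyperarc occurs within `K` steps
(`IsDerivation.exists_early`). Hence an arc between two vertices of `M n` is present in `M (n + K)`;
a vertex of `M n` with a target outside `M n` shows such a target by `M (n + 2 * K + 1)`; and every
vertex of the generated graph has the same arcs, up to isomorphism, as one in `M (K + 1)`, which
carries a terminal hyperarc by `M (2 * K + 1)`. Pumping up, a vertex of `M n` with a target outside
`M (n + K)` has infinitely many targets (`IsDerivation.arcTargets_subset_of_finite`).

So finitely many stages of one derivation decide the question (`IsDerivation.hasUnitWeights_iff`),
and one derivation suffices because all generated graphs are isomorphic. These stages are computed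
by a primitive recursive simulation with explicit fresh vertices. The weights then enter only
through membership in `[0, 1]` and through finitely many equations `∑ nᵢ xᵢ = 1`, which are the two
assumed decidable questions. -/

/-! ### Hypergraphs and their images under maps of vertices -/

theorem hyperVertices_mono {H H' : Set Hyperarc} (h : H ⊆ H') :
    hyperVertices H ⊆ hyperVertices H' :=
  fun _ ⟨X, hX, hv⟩ => ⟨X, h hX, hv⟩

theorem hyperVertices_singleton (X : Hyperarc) : hyperVertices {X} = {v | v ∈ X.2} := by
  ext v; simp [hyperVertices]

theorem terminalPart_subset (H : Set Hyperarc) : terminalPart H ⊆ H := fun _ h => h.1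

theorem Hyperarc.mapVertices_congr {f g : ℕ → ℕ} {X : Hyperarc} (h : ∀ v ∈ X.2, f v = g v) :
    X.mapVertices f = X.mapVertices g := by
  simp only [Hyperarc.mapVertices, Prod.mk.injEq, true_and]
  exact List.map_congr_left h

theorem Hyperarc.mapVertices_mapVertices (f g : ℕ → ℕ) (X : Hyperarc) :
    (X.mapVertices f).mapVertices g = X.mapVertices (g ∘ f) := by
  simp [Hyperarc.mapVertices]

theorem Hyperarc.mem_mapVertices {f : ℕ → ℕ} {X : Hyperarc} {v : ℕ} :
    v ∈ (X.mapVertices f).2 ↔ ∃ u ∈ X.2, f u = v := by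
  simp [Hyperarc.mapVertices]

theorem hyperVertices_image (f : ℕ → ℕ) (H : Set Hyperarc) :
    hyperVertices (Hyperarc.mapVertices f '' H) = f '' hyperVertices H := by
  ext v
  simp only [hyperVertices, Set.mem_ofPred_eq, Set.mem_image]
  constructor
  · rintro ⟨_, ⟨X, hX, rfl⟩, hv⟩
    obtain ⟨u, hu, rfl⟩ := Hyperarc.mem_mapVertices.1 hv
    exact ⟨u, ⟨X, hX, hu⟩, rfl⟩
  · rintro ⟨u, ⟨X, hX, hu⟩, rfl⟩
    exact ⟨_, ⟨X, hX, rfl⟩, Hyperarc.mem_mapVertices.2 ⟨u, hu, rfl⟩⟩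

theorem terminalPart_image (f : ℕ → ℕ) (H : Set Hyperarc) :
    terminalPart (Hyperarc.mapVertices f '' H) = Hyperarc.mapVertices f '' terminalPart H := by
  ext Y
  constructor
  · rintro ⟨⟨X, hX, rfl⟩, h⟩
    exact ⟨X, ⟨hX, h⟩, rfl⟩
  · rintro ⟨X, ⟨hX, h⟩, rfl⟩
    exact ⟨⟨X, hX, rfl⟩, h⟩

/-- The hypergraph isomorphic to `H` along `f` has isomorphic sets of arc targets. -/
theorem arcTargets_image {f : ℕ → ℕ} {H : Set Hyperarc} (hf : Set.InjOn f (hyperVertices H))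
    {v : ℕ} (hv : v ∈ hyperVertices H) (a : ℕ) :
    arcTargets (Hyperarc.mapVertices f '' H) (f v) a = f '' arcTargets H v a := by
  ext u
  constructor
  · rintro ⟨⟨s, l⟩, hX, h⟩
    simp only [Hyperarc.mapVertices, Prod.mk.injEq] at h
    obtain ⟨rfl, h⟩ := h
    match l, h with
    | [x, y], h =>
      simp only [List.map_cons, List.map_nil, List.cons.injEq, and_true] at h
      have hx : x = v := hf ⟨_, hX, by simp⟩ hv h.1
      subst hx
      exact ⟨y, hX, h.2⟩
    | [], h => simp at h
    | [_], h => simp at h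
    | _ :: _ :: _ :: _, h => simp at h
  · rintro ⟨y, hy, rfl⟩
    exact ⟨_, hy, by simp [Hyperarc.mapVertices]⟩

theorem arcTargets_subset_hyperVertices (H : Set Hyperarc) (v a : ℕ) :
    arcTargets H v a ⊆ hyperVertices H := fun _ h => ⟨_, h, by simp⟩

theorem list_map_injOn {α β : Type*} {f : α → β} {s : Set α} (hf : Set.InjOn f s) :
    ∀ {l l' : List α}, (∀ x ∈ l, x ∈ s) → (∀ x ∈ l', x ∈ s) → l.map f = l'.map f → l = l'
  | [], [], _, _, _ => rfl
  | [], _ :: _, _, _, h => by simp at h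
  | _ :: _, [], _, _, h => by simp at h
  | x :: l, y :: l', h1, h2, h => by
    simp only [List.map_cons, List.cons.injEq] at h
    simp only [List.forall_mem_cons] at h1 h2
    rw [hf h1.1 h2.1 h.1, list_map_injOn hf h1.2 h2.2 h.2]

/-! ### A single complete parallel rewriting -/

namespace HRGrammar

variable {G : HRGrammar}

/-- The result of replacing all non-terminal hyperarcs `A vs` of `S` along the maps `h A vs`. -/
def rewrite (G : HRGrammar) (h : ℕ → List ℕ → ℕ → ℕ) (S : Set Hyperarc) : Set Hyperarc :=
  terminalPart S ∪
    {Y | ∃ A vs, (HRSymbol.nonterminal A, vs) ∈ S ∧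
      ∃ X ∈ G.rhs A, Y = Hyperarc.mapVertices (h A vs) X}

/-- The conditions on the maps `h A vs` in a complete parallel rewriting of `S`. -/
structure IsRewriting (G : HRGrammar) (h : ℕ → List ℕ → ℕ → ℕ) (S : Set Hyperarc) : Prop where
  repl : ∀ A vs, (HRSymbol.nonterminal A, vs) ∈ S → G.IsReplacement S A vs (h A vs)
  disj : ∀ A vs B ws, (HRSymbol.nonterminal A, vs) ∈ S → (HRSymbol.nonterminal B, ws) ∈ S →
    (A, vs) ≠ (B, ws) →
    Disjoint (h A vs '' G.innerVertices A) (h B ws '' G.innerVertices B)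

theorem parallelRewrites_iff {M M' : Set Hyperarc} :
    G.ParallelRewrites M M' ↔ ∃ h, G.IsRewriting h M ∧ M' = G.rewrite h M :=
  ⟨fun ⟨h, h1, h2, h3⟩ => ⟨h, ⟨h1, h2⟩, h3⟩, fun ⟨h, h1, h2⟩ => ⟨h, h1.repl, h1.disj, h2⟩⟩

theorem rewrite_mono (h : ℕ → List ℕ → ℕ → ℕ) {S S' : Set Hyperarc} (hS : S ⊆ S') :
    G.rewrite h S ⊆ G.rewrite h S' := by
  rintro Y (hY | ⟨A, vs, hA, hX⟩)
  · exact Or.inl ⟨hS hY.1, hY.2⟩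
  · exact Or.inr ⟨A, vs, hS hA, hX⟩

/-- Rewriting acts on each hyperarc separately. This is what gives every hyperarc a parent and later
a chain of ancestors. -/
theorem mem_rewrite_iff (h : ℕ → List ℕ → ℕ → ℕ) {S : Set Hyperarc} {Y : Hyperarc} :
    Y ∈ G.rewrite h S ↔ ∃ X ∈ S, Y ∈ G.rewrite h {X} := by
  constructor
  · rintro (hY | ⟨A, vs, hA, hX⟩)
    · exact ⟨Y, hY.1, Or.inl ⟨rfl, hY.2⟩⟩
    · exact ⟨_, hA, Or.inr ⟨A, vs, rfl, hX⟩⟩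
  · rintro ⟨X, hX, hY⟩
    exact rewrite_mono h (Set.singleton_subset_iff.2 hX) hY

theorem IsReplacement.anti {S S' : Set Hyperarc} (hS : S ⊆ S') {A : ℕ} {vs : List ℕ} {h : ℕ → ℕ}
    (H : G.IsReplacement S' A vs h) : G.IsReplacement S A vs h :=
  ⟨H.map_inputs, H.injOn, fun w hw hv => H.fresh w hw (hyperVertices_mono hS hv)⟩

/-- In a smaller hypergraph there are fewer vertices to avoid and fewer copies to keep apart. Hence
part of a derivation can be studied on its own. -/
theorem IsRewriting.anti {S S' : Set Hyperarc} (hS : S ⊆ S') {h : ℕ → List ℕ → ℕ → ℕ}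
    (H : G.IsRewriting h S') : G.IsRewriting h S :=
  ⟨fun A vs hA => (H.repl A vs (hS hA)).anti hS,
    fun A vs B ws hA hB => H.disj A vs B ws (hS hA) (hS hB)⟩

/-- The label and the number of vertices of a hyperarc decide whether it is one over `G`. -/
theorem IsHyperarc.of_eq {X Y : Hyperarc} (h1 : X.1 = Y.1) (h2 : X.2.length = Y.2.length)
    (hX : G.IsHyperarc X) : G.IsHyperarc Y := by
  obtain ⟨s, l⟩ := X
  obtain ⟨s', l'⟩ := Y
  simp only at h1 h2
  subst h1
  cases s <;> simpa only [IsHyperarc, h2] using hX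

theorem IsHyperarc.rewrite (hG : G.IsValid) {h : ℕ → List ℕ → ℕ → ℕ} {S : Set Hyperarc}
    (hS : ∀ X ∈ S, G.IsHyperarc X) : ∀ Y ∈ G.rewrite h S, G.IsHyperarc Y := by
  rintro Y (hY | ⟨A, vs, hA, X, hX, rfl⟩)
  · exact hS _ hY.1
  · exact IsHyperarc.of_eq (X := X) rfl (by simp [Hyperarc.mapVertices])
      (hG.rhs_isHyperarc A (hS _ hA).1 X hX)

/-- A vertex of the result of a rewriting is old or new. -/
theorem mem_hyperVertices_rewrite {h : ℕ → List ℕ → ℕ → ℕ} {S : Set Hyperarc}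
    (H : G.IsRewriting h S) {v : ℕ} (hv : v ∈ hyperVertices (G.rewrite h S)) :
    v ∈ hyperVertices S ∨ ∃ A vs, (HRSymbol.nonterminal A, vs) ∈ S ∧
      ∃ w ∈ G.innerVertices A, h A vs w = v := by
  obtain ⟨Y, hY | ⟨A, vs, hA, X, hX, rfl⟩, hv⟩ := hv
  · exact Or.inl ⟨Y, hY.1, hv⟩
  · obtain ⟨w, hw, rfl⟩ := Hyperarc.mem_mapVertices.1 hv
    by_cases hi : w ∈ G.inputs A
    · have hm := List.mem_map_of_mem (f := h A vs) hi
      rw [(H.repl A vs hA).map_inputs] at hm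
      exact Or.inl ⟨_, hA, hm⟩
    · exact Or.inr ⟨A, vs, hA, w, ⟨⟨X, hX, hw⟩, hi⟩, rfl⟩

/-- No vertex gets lost when a non-terminal is removed, because each input of `H_A` lies on some
hyperarc of `H_A`. -/
theorem hyperVertices_subset_rewrite (hG : G.IsValid) {h : ℕ → List ℕ → ℕ → ℕ}
    {S : Set Hyperarc} (hS : ∀ X ∈ S, G.IsHyperarc X) (H : G.IsRewriting h S) :
    hyperVertices S ⊆ hyperVertices (G.rewrite h S) := by
  rintro v ⟨⟨s, l⟩, hX, hv⟩
  by_cases hs : ∃ A, s = HRSymbol.nonterminal A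
  · obtain ⟨A, rfl⟩ := hs
    have hm := (H.repl A l hX).map_inputs
    simp only at hv
    rw [← hm] at hv
    obtain ⟨w, hw, rfl⟩ := List.mem_map.1 hv
    obtain ⟨Y, hY, hwY⟩ := hG.inputs_mem A (hS _ hX).1 w hw
    exact ⟨_, Or.inr ⟨A, l, hX, Y, hY, rfl⟩, Hyperarc.mem_mapVertices.2 ⟨w, hwY, rfl⟩⟩
  · exact ⟨_, Or.inl ⟨hX, fun A hA => hs ⟨A, hA⟩⟩, hv⟩

/-- An isomorphism extends over complete parallel rewritings. -/
theorem exists_extension_rewrite {h h' : ℕ → List ℕ → ℕ → ℕ} {S : Set Hyperarc}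
    {φ : ℕ → ℕ} (H : G.IsRewriting h S) (H' : G.IsRewriting h' (Hyperarc.mapVertices φ '' S))
    (hφ : Set.InjOn φ (hyperVertices S)) :
    ∃ ψ : ℕ → ℕ, Set.EqOn ψ φ (hyperVertices S) ∧
      Set.InjOn ψ (hyperVertices (G.rewrite h S)) ∧
      G.rewrite h' (Hyperarc.mapVertices φ '' S) =
        Hyperarc.mapVertices ψ '' G.rewrite h S := by
  classical
  -- A new vertex is identified by its origin `(A, vs, w)`. The origin is unique by injectivity
  -- within a copy and disjointness of different copies.
  let New : ℕ → ℕ × List ℕ × ℕ → Prop := fun v t =>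
    (HRSymbol.nonterminal t.1, t.2.1) ∈ S ∧ t.2.2 ∈ G.innerVertices t.1 ∧ h t.1 t.2.1 t.2.2 = v
  have uniq : ∀ v t t', New v t → New v t' → t = t' := by
    rintro v ⟨A, vs, w⟩ ⟨B, ws, u⟩ ⟨h1, h2, h3⟩ ⟨h1', h2', h3'⟩
    simp only at h1 h2 h3 h1' h2' h3'
    by_cases hne : (A, vs) = (B, ws)
    · obtain ⟨rfl, rfl⟩ := Prod.mk.inj hne
      have := (H.repl A vs h1).injOn h2 h2' (h3.trans h3'.symm)
      rw [this]
    · exact absurd rfl ((H.disj A vs B ws h1 h1' hne).ne_of_mem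
        ⟨w, h2, h3⟩ ⟨u, h2', h3'⟩)
  -- Old vertices follow `φ`, and a new vertex goes to the new vertex of corresponding origin. The
  -- value `0` is taken only outside the rewritten hypergraph.
  let ψ : ℕ → ℕ := fun v => if v ∈ hyperVertices S then φ v else
    if ht : ∃ t, New v t then h' ht.choose.1 (ht.choose.2.1.map φ) ht.choose.2.2 else 0
  have ψold : Set.EqOn ψ φ (hyperVertices S) := fun v hv => if_pos hv
  have memS' : ∀ {A vs}, (HRSymbol.nonterminal A, vs) ∈ S →
      (HRSymbol.nonterminal A, vs.map φ) ∈ Hyperarc.mapVertices φ '' S :=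
    fun hA => ⟨_, hA, rfl⟩
  have ψnew : ∀ A vs, (HRSymbol.nonterminal A, vs) ∈ S → ∀ w ∈ G.innerVertices A,
      ψ (h A vs w) = h' A (vs.map φ) w := by
    intro A vs hA w hw
    have hex : ∃ t, New (h A vs w) t := ⟨(A, vs, w), hA, hw, rfl⟩
    have e := uniq _ _ (A, vs, w) hex.choose_spec ⟨hA, hw, rfl⟩
    simp only [ψ]
    rw [if_neg ((H.repl A vs hA).fresh w hw), dif_pos hex, e]
  have ψall : ∀ A vs, (HRSymbol.nonterminal A, vs) ∈ S → ∀ w ∈ hyperVertices (G.rhs A),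
      ψ (h A vs w) = h' A (vs.map φ) w := by
    intro A vs hA w hw
    by_cases hi : w ∈ G.inputs A
    · have e1 := (H.repl A vs hA).map_inputs
      have e2 := (H'.repl A _ (memS' hA)).map_inputs
      have hv : h A vs w ∈ vs := by
        have hm := List.mem_map_of_mem (f := h A vs) hi
        rwa [e1] at hm
      rw [ψold ⟨_, hA, hv⟩]
      conv_rhs at e2 => rw [← e1, List.map_map]
      exact (List.map_inj_left.1 e2 w hi).symm
    · exact ψnew A vs hA w ⟨hw, hi⟩
  have ψmap : ∀ A vs, (HRSymbol.nonterminal A, vs) ∈ S → ∀ X ∈ G.rhs A,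
      (X.mapVertices (h A vs)).mapVertices ψ = X.mapVertices (h' A (vs.map φ)) := by
    intro A vs hA X hX
    rw [Hyperarc.mapVertices_mapVertices]
    exact Hyperarc.mapVertices_congr fun w hw => ψall A vs hA w ⟨X, hX, hw⟩
  refine ⟨ψ, ψold, ?_, ?_⟩
  · intro v₁ hv₁ v₂ hv₂ e
    have key : ∀ v ∈ hyperVertices S, ∀ A vs, (HRSymbol.nonterminal A, vs) ∈ S →
        ∀ w ∈ G.innerVertices A, ψ v ≠ ψ (h A vs w) := by
      intro v hv A vs hA w hw e
      rw [ψold hv, ψnew A vs hA w hw] at e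
      apply (H'.repl A _ (memS' hA)).fresh w hw
      rw [← e, hyperVertices_image]
      exact ⟨v, hv, rfl⟩
    rcases mem_hyperVertices_rewrite H hv₁ with h₁ | ⟨A, vs, hA, w, hw, rfl⟩ <;>
    rcases mem_hyperVertices_rewrite H hv₂ with h₂ | ⟨B, ws, hB, u, hu, rfl⟩
    · rw [ψold h₁, ψold h₂] at e
      exact hφ h₁ h₂ e
    · exact absurd e (key _ h₁ B ws hB u hu)
    · exact absurd e.symm (key _ h₂ A vs hA w hw)
    · rw [ψnew A vs hA w hw, ψnew B ws hB u hu] at e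
      by_cases hne : (A, vs.map φ) = (B, ws.map φ)
      · obtain ⟨rfl, h2⟩ := Prod.mk.inj hne
        -- Injectivity of `φ` on the old vertices recovers the replaced hyperarc from its image.
        have hvw : vs = ws := list_map_injOn hφ (fun x hx => ⟨_, hA, hx⟩)
          (fun x hx => ⟨_, hB, hx⟩) h2
        subst hvw
        rw [(H'.repl A _ (memS' hA)).injOn hw hu e]
      · exact absurd e ((H'.disj A _ B _ (memS' hA) (memS' hB) hne).ne_of_mem
          ⟨w, hw, rfl⟩ ⟨u, hu, rfl⟩)
  · ext Y
    constructor
    · rintro (hY | ⟨A, vs', ⟨⟨s, vs⟩, hA, hAe⟩, X, hX, rfl⟩)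
      · rw [terminalPart_image] at hY
        obtain ⟨X, hX, rfl⟩ := hY
        exact ⟨X, Or.inl hX, Hyperarc.mapVertices_congr fun v hv => ψold ⟨X, hX.1, hv⟩⟩
      · simp only [Hyperarc.mapVertices, Prod.mk.injEq] at hAe
        obtain ⟨rfl, rfl⟩ := hAe
        exact ⟨_, Or.inr ⟨A, vs, hA, X, hX, rfl⟩, ψmap A vs hA X hX⟩
    · rintro ⟨X, hX | ⟨A, vs, hA, X, hX, rfl⟩, rfl⟩
      · refine Or.inl ?_
        rw [terminalPart_image]
        exact ⟨X, hX, Hyperarc.mapVertices_congr fun v hv => (ψold ⟨X, hX.1, hv⟩).symm⟩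
      · exact Or.inr ⟨A, vs.map φ, memS' hA, X, hX, ψmap A vs hA X hX⟩

end HRGrammar

/-! ### Derivations, descendants, and the extension of isomorphisms -/

namespace HRGrammar

variable {G : HRGrammar}

/-- `M` is an infinite sequence of complete parallel rewritings along the maps `h`. -/
structure IsDerivation (G : HRGrammar) (M : ℕ → Set Hyperarc) (h : ℕ → ℕ → List ℕ → ℕ → ℕ) :
    Prop where
  isHyperarc_zero : ∀ X ∈ M 0, G.IsHyperarc X
  isRewriting : ∀ n, G.IsRewriting (h n) (M n)
  succ : ∀ n, M (n + 1) = G.rewrite (h n) (M n)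

/-- The hypergraph obtained from the set `S` of hyperarcs at time `n` after `t` rewritings. -/
def descendants (G : HRGrammar) (h : ℕ → ℕ → List ℕ → ℕ → ℕ) (n : ℕ) (S : Set Hyperarc) :
    ℕ → Set Hyperarc
  | 0 => S
  | t + 1 => G.rewrite (h (n + t)) (descendants G h n S t)

/-- The graph generated along a derivation. -/
def limitGraph (M : ℕ → Set Hyperarc) : Set Hyperarc := ⋃ n, terminalPart (M n)

theorem mem_limitGraph {M : ℕ → Set Hyperarc} {X : Hyperarc} :
    X ∈ limitGraph M ↔ ∃ n, X ∈ terminalPart (M n) := Set.mem_iUnion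

theorem limitGraph_subset_iUnion (M : ℕ → Set Hyperarc) : limitGraph M ⊆ ⋃ n, M n :=
  Set.iUnion_mono fun _ => terminalPart_subset _

theorem descendants_mono (h : ℕ → ℕ → List ℕ → ℕ → ℕ) (n : ℕ) {S S' : Set Hyperarc}
    (hS : S ⊆ S') (t : ℕ) : G.descendants h n S t ⊆ G.descendants h n S' t := by
  induction t with
  | zero => exact hS
  | succ t ih => exact rewrite_mono _ ih

theorem descendants_add (h : ℕ → ℕ → List ℕ → ℕ → ℕ) (n : ℕ) (S : Set Hyperarc) (s t : ℕ) :
    G.descendants h n S (s + t) = G.descendants h (n + s) (G.descendants h n S s) t := by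
  induction t with
  | zero => rfl
  | succ t ih =>
    change G.rewrite _ (G.descendants h n S (s + t)) = G.rewrite _ _
    rw [ih, Nat.add_assoc]
    rfl

theorem mem_descendants_iff (h : ℕ → ℕ → List ℕ → ℕ → ℕ) (n : ℕ) {S : Set Hyperarc} (t : ℕ)
    {Y : Hyperarc} :
    Y ∈ G.descendants h n S t ↔ ∃ X ∈ S, Y ∈ G.descendants h n {X} t := by
  induction t generalizing Y with
  | zero => simp [descendants]
  | succ t ih =>
    constructor
    · intro hY
      obtain ⟨Z, hZ, hY⟩ := (mem_rewrite_iff _).1 hY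
      obtain ⟨X, hX, hZ⟩ := ih.1 hZ
      exact ⟨X, hX, (mem_rewrite_iff _).2 ⟨Z, hZ, hY⟩⟩
    · rintro ⟨X, hX, hY⟩
      exact descendants_mono h n (Set.singleton_subset_iff.2 hX) _ hY

/-- The successive ancestors of a descendant. -/
theorem exists_ancestors (h : ℕ → ℕ → List ℕ → ℕ → ℕ) (n : ℕ) {X Y : Hyperarc} {t : ℕ}
    (hY : Y ∈ G.descendants h n {X} t) :
    ∃ Z : ℕ → Hyperarc, Z 0 = X ∧ Z t = Y ∧
      ∀ i j, i ≤ j → j ≤ t → Z j ∈ G.descendants h (n + i) {Z i} (j - i) := by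
  induction t generalizing Y with
  | zero =>
    refine ⟨fun _ => X, rfl, hY.symm, fun i j hij hj => ?_⟩
    obtain rfl : j = 0 := by omega
    obtain rfl : i = 0 := by omega
    rfl
  | succ t ih =>
    obtain ⟨W, hW, hYW⟩ := (mem_rewrite_iff _).1 hY
    obtain ⟨Z, hZ0, hZt, hZ⟩ := ih hW
    refine ⟨fun i => if i ≤ t then Z i else Y, by simp [hZ0], by simp, fun i j hij hj => ?_⟩
    by_cases hjt : j ≤ t
    · simp only [hjt, hij.trans hjt, if_true]
      exact hZ i j hij hjt
    · obtain rfl : j = t + 1 := by omega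
      by_cases hit : i ≤ t
      · simp only [hit, if_true, hjt, if_false]
        have := hZ i t hit le_rfl
        rw [hZt] at this
        rw [show t + 1 - i = (t - i) + 1 by omega]
        change Y ∈ G.rewrite _ _
        rw [show n + i + (t - i) = n + t by omega]
        exact (mem_rewrite_iff _).2 ⟨W, this, hYW⟩
      · obtain rfl : i = t + 1 := by omega
        simp [descendants]

section IsDerivation

variable {M : ℕ → Set Hyperarc} {h : ℕ → ℕ → List ℕ → ℕ → ℕ}

theorem IsDerivation.isHyperarc (hG : G.IsValid) (D : G.IsDerivation M h) (n : ℕ) :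
    ∀ X ∈ M n, G.IsHyperarc X := by
  induction n with
  | zero => exact D.isHyperarc_zero
  | succ n ih => rw [D.succ]; exact IsHyperarc.rewrite hG ih

theorem IsDerivation.descendants_eq (D : G.IsDerivation M h) (n t : ℕ) :
    G.descendants h n (M n) t = M (n + t) := by
  induction t with
  | zero => rfl
  | succ t ih => rw [descendants, ih, ← Nat.add_assoc, D.succ]

theorem IsDerivation.descendants_subset (D : G.IsDerivation M h) {n : ℕ} {S : Set Hyperarc}
    (hS : S ⊆ M n) (t : ℕ) : G.descendants h n S t ⊆ M (n + t) :=
  D.descendants_eq n t ▸ descendants_mono h n hS t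

/-- The descendants of hyperarcs of a derivation form a derivation. -/
theorem IsDerivation.descendants (hG : G.IsValid) (D : G.IsDerivation M h) {n : ℕ}
    {S : Set Hyperarc} (hS : S ⊆ M n) :
    G.IsDerivation (G.descendants h n S) (fun t => h (n + t)) where
  isHyperarc_zero X hX := D.isHyperarc hG n X (hS hX)
  isRewriting t := (D.isRewriting (n + t)).anti (D.descendants_subset hS t)
  succ _ := rfl

theorem IsDerivation.hyperVertices_mono (hG : G.IsValid) (D : G.IsDerivation M h) {m n : ℕ}
    (hmn : m ≤ n) : hyperVertices (M m) ⊆ hyperVertices (M n) := by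
  induction n, hmn using Nat.le_induction with
  | base => exact subset_rfl
  | succ n _ ih =>
    rw [D.succ]
    exact ih.trans (hyperVertices_subset_rewrite hG (D.isHyperarc hG n) (D.isRewriting n))

theorem IsDerivation.terminalPart_mono (D : G.IsDerivation M h) {m n : ℕ}
    (hmn : m ≤ n) : terminalPart (M m) ⊆ terminalPart (M n) := by
  induction n, hmn using Nat.le_induction with
  | base => exact subset_rfl
  | succ n _ ih =>
    rw [D.succ]
    exact fun X hX => ⟨Or.inl (ih hX), hX.2⟩

/-- The descendants of `S` contain no vertices of `M n` except those of `S`. -/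
theorem IsDerivation.not_mem_hyperVertices (hG : G.IsValid) (D : G.IsDerivation M h) {n : ℕ}
    {S : Set Hyperarc} (hS : S ⊆ M n) {t : ℕ} {v : ℕ}
    (hv : v ∈ hyperVertices (G.descendants h n S t)) (hvS : v ∉ hyperVertices S) :
    v ∉ hyperVertices (M n) := by
  induction t with
  | zero => exact absurd hv hvS
  | succ t ih =>
    rcases mem_hyperVertices_rewrite ((D.descendants hG hS).isRewriting t) hv with
      hv | ⟨A, vs, hA, w, hw, rfl⟩
    · exact ih hv
    · exact fun hm => ((D.isRewriting (n + t)).repl A vs (D.descendants_subset hS t hA)).fresh w hw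
        (D.hyperVertices_mono hG (Nat.le_add_right n t) hm)

/-- All other vertices of the descendants of `X` are fresh. The lemma keeps distinguished vertices
on every member of a chain of ancestors. -/
theorem IsDerivation.mem_of_mem_descendants (hG : G.IsValid) (D : G.IsDerivation M h) {n : ℕ}
    {X Y : Hyperarc} (hX : X ∈ M n) {t : ℕ} (hY : Y ∈ G.descendants h n {X} t) {v : ℕ}
    (hvY : v ∈ Y.2) (hv : v ∈ hyperVertices (M n)) : v ∈ X.2 := by
  by_contra hvX
  exact D.not_mem_hyperVertices hG (Set.singleton_subset_iff.2 hX) ⟨Y, hY, hvY⟩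
    (by rwa [hyperVertices_singleton]) hv

/-- Isomorphisms of the initial hypergraphs extend to isomorphisms of derivations. -/
theorem IsDerivation.exists_extension (hG : G.IsValid) (D : G.IsDerivation M h)
    {M' : ℕ → Set Hyperarc} {h' : ℕ → ℕ → List ℕ → ℕ → ℕ} (D' : G.IsDerivation M' h')
    {φ : ℕ → ℕ} (hφ : Set.InjOn φ (hyperVertices (M 0)))
    (h0 : M' 0 = Hyperarc.mapVertices φ '' M 0) :
    ∃ Φ : ℕ → ℕ, Set.EqOn Φ φ (hyperVertices (M 0)) ∧
      ∀ t, Set.InjOn Φ (hyperVertices (M t)) ∧ M' t = Hyperarc.mapVertices Φ '' M t := by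
  classical
  -- The hypothesis on `f` is placed under the existential quantifier so that `choose` yields a
  -- total function to iterate.
  have step : ∀ t (f : ℕ → ℕ), ∃ g : ℕ → ℕ,
      (Set.InjOn f (hyperVertices (M t)) ∧ M' t = Hyperarc.mapVertices f '' M t) →
      Set.EqOn g f (hyperVertices (M t)) ∧ Set.InjOn g (hyperVertices (M (t + 1))) ∧
        M' (t + 1) = Hyperarc.mapVertices g '' M (t + 1) := by
    intro t f
    by_cases hf : Set.InjOn f (hyperVertices (M t)) ∧ M' t = Hyperarc.mapVertices f '' M t
    · have R' := D'.isRewriting t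
      rw [hf.2] at R'
      obtain ⟨g, h1, h2, h3⟩ := exists_extension_rewrite (D.isRewriting t) R' hf.1
      refine ⟨g, fun _ => ⟨h1, ?_, ?_⟩⟩
      · rwa [D.succ]
      · rw [D'.succ, hf.2, h3, D.succ]
    · exact ⟨f, fun hf' => absurd hf' hf⟩
  choose next hnext using step
  let F : ℕ → ℕ → ℕ := fun t => Nat.rec φ next t
  have hF : ∀ t, Set.InjOn (F t) (hyperVertices (M t)) ∧
      M' t = Hyperarc.mapVertices (F t) '' M t := by
    intro t
    induction t with
    | zero => exact ⟨hφ, h0⟩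
    | succ t ih => exact (hnext t (F t) ih).2
  have hEq : ∀ s t, s ≤ t → Set.EqOn (F t) (F s) (hyperVertices (M s)) := by
    intro s t hst
    induction t, hst using Nat.le_induction with
    | base => exact fun _ _ => rfl
    | succ t hst ih =>
      exact fun v hv => ((hnext t (F t) (hF t)).1 (D.hyperVertices_mono hG hst hv)).trans (ih hv)
  -- The maps `F t` agree where they overlap, so each vertex may take the value from the first stage
  -- that contains it.
  let Φ : ℕ → ℕ := fun v => if hv : ∃ t, v ∈ hyperVertices (M t) then F (Nat.find hv) v else 0
  have hΦ : ∀ t, Set.EqOn Φ (F t) (hyperVertices (M t)) := by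
    intro t v hv
    have hex : ∃ t, v ∈ hyperVertices (M t) := ⟨t, hv⟩
    simp only [Φ, dif_pos hex]
    exact (hEq _ t (Nat.find_min' hex hv) (Nat.find_spec hex)).symm
  refine ⟨Φ, hΦ 0, fun t => ⟨(hF t).1.congr (hΦ t).symm, ?_⟩⟩
  rw [(hF t).2]
  exact Set.image_congr fun X hX =>
    Hyperarc.mapVertices_congr fun v hv => (hΦ t ⟨X, hX, hv⟩).symm

/-- Isomorphic hyperarcs have isomorphic descendants. -/
theorem IsDerivation.exists_extension_descendants (hG : G.IsValid) (D : G.IsDerivation M h)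
    {m n : ℕ} {X : Hyperarc} (hX : X ∈ M m) {φ : ℕ → ℕ} (hX' : X.mapVertices φ ∈ M n)
    (hφ : Set.InjOn φ {v | v ∈ X.2}) :
    ∃ Φ : ℕ → ℕ, (∀ v ∈ X.2, Φ v = φ v) ∧
      ∀ t, Set.InjOn Φ (hyperVertices (G.descendants h m {X} t)) ∧
        G.descendants h n {X.mapVertices φ} t =
          Hyperarc.mapVertices Φ '' G.descendants h m {X} t := by
  obtain ⟨Φ, h1, h2⟩ := IsDerivation.exists_extension hG (D.descendants hG (Set.singleton_subset_iff.2 hX))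
    (D.descendants hG (Set.singleton_subset_iff.2 hX')) (φ := φ)
    (by simpa [HRGrammar.descendants, hyperVertices_singleton] using hφ)
    (by simp [HRGrammar.descendants])
  exact ⟨Φ, fun v hv => h1 ⟨X, rfl, hv⟩, h2⟩

theorem injOn_iUnion_hyperVertices (hG : G.IsValid) (D : G.IsDerivation M h) {Φ : ℕ → ℕ}
    (hΦ : ∀ t, Set.InjOn Φ (hyperVertices (M t))) : Set.InjOn Φ (hyperVertices (⋃ t, M t)) := by
  have mem : ∀ {v}, v ∈ hyperVertices (⋃ t, M t) → ∃ t, v ∈ hyperVertices (M t) := by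
    rintro v ⟨X, hX, hv⟩
    obtain ⟨t, ht⟩ := Set.mem_iUnion.1 hX
    exact ⟨t, X, ht, hv⟩
  intro u hu v hv e
  obtain ⟨s, hs⟩ := mem hu
  obtain ⟨t, ht⟩ := mem hv
  exact hΦ (max s t) (D.hyperVertices_mono hG (le_max_left s t) hs)
    (D.hyperVertices_mono hG (le_max_right s t) ht) e

theorem limitGraph_image {M M' : ℕ → Set Hyperarc} {Φ : ℕ → ℕ}
    (hΦ : ∀ t, M' t = Hyperarc.mapVertices Φ '' M t) :
    limitGraph M' = Hyperarc.mapVertices Φ '' limitGraph M := by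
  simp only [limitGraph, Set.image_iUnion, ← terminalPart_image, hΦ]

end IsDerivation

end HRGrammar

/-! ### Types of hyperarcs, the pigeonhole principle, and pumping down -/

namespace HRGrammar

variable {G : HRGrammar}

/-- An isomorphism of the hyperarcs `X` and `Y` fixes the vertices in `us`. -/
def SameType (us : List ℕ) (X Y : Hyperarc) : Prop :=
  ∃ φ : ℕ → ℕ, Set.InjOn φ {v | v ∈ X.2} ∧ X.mapVertices φ = Y ∧ ∀ u ∈ us, φ u = u

theorem SameType.refl (us : List ℕ) (X : Hyperarc) : SameType us X X :=
  ⟨id, Set.injOn_id _, by simp [Hyperarc.mapVertices], fun _ _ => rfl⟩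

theorem SameType.trans {us : List ℕ} {X Y Z : Hyperarc} (h : SameType us X Y)
    (h' : SameType us Y Z) : SameType us X Z := by
  obtain ⟨φ, h1, rfl, h2⟩ := h
  obtain ⟨ψ, h3, rfl, h4⟩ := h'
  refine ⟨ψ ∘ φ, h3.comp h1 fun v hv => Hyperarc.mem_mapVertices.2 ⟨v, hv, rfl⟩,
    (Hyperarc.mapVertices_mapVertices _ _ _).symm, fun u hu => ?_⟩
  simp [h2 u hu, h4 u hu]

theorem SameType.mem {us : List ℕ} {X Y : Hyperarc} (h : SameType us X Y) {u : ℕ}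
    (hu : u ∈ us) (huX : u ∈ X.2) : u ∈ Y.2 := by
  obtain ⟨φ, _, rfl, h2⟩ := h
  exact Hyperarc.mem_mapVertices.2 ⟨u, huX, h2 u hu⟩

theorem SameType.label_eq {us : List ℕ} {X Y : Hyperarc} (h : SameType us X Y) : X.1 = Y.1 := by
  obtain ⟨φ, _, rfl, _⟩ := h
  rfl

theorem SameType.eq_of_subset {us : List ℕ} {X Y : Hyperarc} (h : SameType us X Y)
    (hX : ∀ v ∈ X.2, v ∈ us) : Y = X := by
  obtain ⟨φ, _, rfl, h2⟩ := h
  have : X.mapVertices φ = X.mapVertices id :=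
    Hyperarc.mapVertices_congr fun v hv => h2 v (hX v hv)
  simpa [Hyperarc.mapVertices] using this

/-- Lists with the same equalities between their entries correspond along an injective map. -/
theorem exists_injOn_map_eq {l l' : List ℕ} (hlen : l.length = l'.length)
    (h : ∀ i j, i < l.length → j < l.length → (l[i]? = l[j]? ↔ l'[i]? = l'[j]?)) :
    ∃ φ : ℕ → ℕ, Set.InjOn φ {v | v ∈ l} ∧ l.map φ = l' := by
  -- The map sends a vertex of `l` to the entry of `l'` at the vertex's first position in `l`; by
  -- the equality pattern, any other position of that vertex gives the same entry.
  have key : ∀ i, i < l.length → l'[l.idxOf (l.getD i 0)]? = l'[i]? := by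
    intro i hi
    have hm : l.getD i 0 ∈ l := by
      rw [List.getD_eq_getElem _ _ hi]; exact List.getElem_mem _
    have hlt := List.idxOf_lt_length_of_mem hm
    rw [← h _ _ hlt hi, List.getElem?_eq_getElem hlt, List.getElem_idxOf,
      List.getElem?_eq_getElem hi, List.getD_eq_getElem _ _ hi]
  refine ⟨fun v => l'.getD (l.idxOf v) 0, ?_, ?_⟩
  · intro u hu v hv e
    have hu' := List.idxOf_lt_length_of_mem hu
    have hv' := List.idxOf_lt_length_of_mem hv
    simp only at e
    rw [List.getD_eq_getElem _ _ (hlen ▸ hu'), List.getD_eq_getElem _ _ (hlen ▸ hv')] at e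
    have := (h _ _ hu' hv').2 (by
      rw [List.getElem?_eq_getElem (hlen ▸ hu'), List.getElem?_eq_getElem (hlen ▸ hv'), e])
    simpa [List.getElem?_eq_getElem hu', List.getElem?_eq_getElem hv'] using this
  · apply List.ext_getElem (by simp [hlen])
    intro i h1 h2
    have h1' : i < l.length := by simpa using h1
    have := key i h1'
    rw [List.getD_eq_getElem _ _ h1'] at this
    simp [List.getD, this, h2]

/-- A bound for the number of vertices of a hyperarc over `G`. -/
def lengthBound (G : HRGrammar) : ℕ := 2 + (G.rules.map fun r => r.2.length).sum

/-- A bound for the number of symbols. -/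
def symbolBound (G : HRGrammar) : ℕ := G.rules.length + G.arcLabels + G.colours

/-- A bound for the number of types of hyperarcs with at most two distinguished vertices. -/
def typeBound (G : HRGrammar) : ℕ :=
  G.symbolBound * 2 ^ ((G.lengthBound + 2) * (G.lengthBound + 2))

/-- The symbols of `G` are numbered from `0` to `G.symbolBound - 1`. -/
def symbolNumber (G : HRGrammar) : HRSymbol → ℕ
  | HRSymbol.nonterminal A => A
  | HRSymbol.arcLabel a => G.rules.length + a
  | HRSymbol.colour c => G.rules.length + G.arcLabels + c

theorem IsHyperarc.symbolNumber_lt {X : Hyperarc} (hX : G.IsHyperarc X) :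
    G.symbolNumber X.1 < G.symbolBound := by
  obtain ⟨s, l⟩ := X
  cases s <;> simp only [IsHyperarc] at hX <;> simp only [symbolNumber, symbolBound] <;> omega

theorem IsHyperarc.symbolNumber_inj {X Y : Hyperarc} (hX : G.IsHyperarc X)
    (hY : G.IsHyperarc Y) (h : G.symbolNumber X.1 = G.symbolNumber Y.1) :
    X.1 = Y.1 ∧ X.2.length = Y.2.length := by
  obtain ⟨s, l⟩ := X
  obtain ⟨s', l'⟩ := Y
  cases s <;> cases s' <;> simp only [IsHyperarc] at hX hY <;> simp only [symbolNumber] at h <;>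
    first
    | omega
    | (obtain rfl := h
       exact ⟨rfl, hX.2.trans hY.2.symm⟩)
    | (obtain rfl := Nat.add_left_cancel h
       exact ⟨rfl, hX.2.trans hY.2.symm⟩)

theorem arity_le (G : HRGrammar) (A : ℕ) :
    G.arity A ≤ (G.rules.map fun r => r.2.length).sum := by
  unfold arity inputs
  by_cases hA : A < G.rules.length
  · rw [List.getD_eq_getElem _ _ hA]
    exact List.single_le_sum (fun _ _ => Nat.zero_le _) _
      (List.mem_map.2 ⟨_, List.getElem_mem hA, rfl⟩)
  · rw [List.getD_eq_default _ _ (not_lt.1 hA)]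
    exact Nat.zero_le _

theorem IsHyperarc.length_le {X : Hyperarc} (hX : G.IsHyperarc X) :
    X.2.length ≤ G.lengthBound := by
  obtain ⟨s, l⟩ := X
  unfold lengthBound
  cases s with
  | nonterminal A =>
    have := G.arity_le A
    simp only [IsHyperarc] at hX ⊢
    omega
  | _ => simp only [IsHyperarc] at hX ⊢; omega

/-- The number and the pattern of equal vertices of a hyperarc with distinguished vertices. -/
def pattern (G : HRGrammar) (us : List ℕ) {X : Hyperarc} (hX : G.IsHyperarc X) :
    Fin G.symbolBound × (Fin (G.lengthBound + 2) → Fin (G.lengthBound + 2) → Bool) :=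
  (⟨G.symbolNumber X.1, hX.symbolNumber_lt⟩,
    fun i j => decide ((X.2 ++ us)[(i : ℕ)]? = (X.2 ++ us)[(j : ℕ)]?))

theorem sameType_of_pattern_eq {us : List ℕ} (hus : us.length ≤ 2) {X Y : Hyperarc}
    (hX : G.IsHyperarc X) (hY : G.IsHyperarc Y) (h : G.pattern us hX = G.pattern us hY) :
    SameType us X Y := by
  simp only [pattern, Prod.mk.injEq, Fin.mk.injEq] at h
  obtain ⟨h1, h2⟩ := hX.symbolNumber_inj hY h.1
  have hl := hX.length_le
  obtain ⟨φ, hφ, he⟩ := exists_injOn_map_eq (l := X.2 ++ us) (l' := Y.2 ++ us) (by simp [h2]) (by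
    intro i j hi hj
    rw [List.length_append] at hi hj
    have := congrFun (congrFun h.2 ⟨i, by omega⟩) ⟨j, by omega⟩
    simpa using this)
  rw [List.map_append] at he
  obtain ⟨e1, e2⟩ := List.append_inj he (by simp [h2])
  refine ⟨φ, hφ.mono fun v hv => List.mem_append_left _ hv, ?_, ?_⟩
  · exact Prod.ext h1 e1
  · exact List.map_inj_left.1 (e2.trans us.map_id.symm)

/-- Among more than `G.typeBound` hyperarcs two have the same type. -/
theorem exists_sameType {us : List ℕ} (hus : us.length ≤ 2) (Z : ℕ → Hyperarc)
    (hZ : ∀ i ≤ G.typeBound, G.IsHyperarc (Z i)) :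
    ∃ i j, i < j ∧ j ≤ G.typeBound ∧ SameType us (Z i) (Z j) ∧ SameType us (Z j) (Z i) := by
  have hZ' : ∀ i : Fin (G.typeBound + 1), G.IsHyperarc (Z i) := fun i => hZ i (by omega)
  obtain ⟨i, j, hne, he⟩ := Fintype.exists_ne_map_eq_of_card_lt
    (fun i : Fin (G.typeBound + 1) => G.pattern us (hZ' i)) (by
      simp only [Fintype.card_prod, Fintype.card_fin, Fintype.card_fun, Fintype.card_bool]
      rw [typeBound, ← pow_mul]
      exact Nat.lt_succ_self _)
  have h1 := sameType_of_pattern_eq hus _ _ he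
  have h2 := sameType_of_pattern_eq hus _ _ he.symm
  rcases lt_or_gt_of_ne hne with hlt | hlt
  · exact ⟨i, j, hlt, by omega, h1, h2⟩
  · exact ⟨j, i, hlt, by omega, h2, h1⟩

section IsDerivation

variable {M : ℕ → Set Hyperarc} {h : ℕ → ℕ → List ℕ → ℕ → ℕ}

/-- Descendants of hyperarcs of the same type have the same types. -/
theorem SameType.exists_descendant (hG : G.IsValid) (D : G.IsDerivation M h) {us : List ℕ}
    {m n t : ℕ} {X X' Y : Hyperarc} (hX : X ∈ M m) (hX' : X' ∈ M n) (hXX' : SameType us X X')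
    (hus : ∀ u ∈ us, u ∈ X.2) (hY : Y ∈ G.descendants h m {X} t) :
    ∃ Y' ∈ G.descendants h n {X'} t, SameType us Y Y' := by
  obtain ⟨φ, hφ, rfl, hfix⟩ := hXX'
  obtain ⟨Φ, hΦφ, hΦ⟩ := D.exists_extension_descendants hG hX hX' hφ
  refine ⟨Y.mapVertices Φ, ?_, Φ, (hΦ t).1.mono fun v hv => ?_, rfl,
    fun u hu => (hΦφ u (hus u hu)).trans (hfix u hu)⟩
  · rw [(hΦ t).2]
    exact Set.mem_image_of_mem _ hY
  · exact ⟨Y, hY, hv⟩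

/-- The type of a descendant appears early. -/
theorem IsDerivation.exists_early (hG : G.IsValid) (D : G.IsDerivation M h) {us : List ℕ}
    (hlen : us.length ≤ 2) {n t : ℕ} {X Y : Hyperarc} (hX : X ∈ M n)
    (hus : ∀ u ∈ us, u ∈ X.2) (hY : Y ∈ G.descendants h n {X} t) (husY : ∀ u ∈ us, u ∈ Y.2) :
    ∃ s ≤ G.typeBound, ∃ Y' ∈ G.descendants h n {X} s, SameType us Y Y' := by
  induction t using Nat.strong_induction_on generalizing Y with
  | _ t ih =>
    by_cases ht : t ≤ G.typeBound
    · exact ⟨t, ht, Y, hY, SameType.refl _ _⟩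
    obtain ⟨Z, hZ0, hZt, hZ⟩ := exists_ancestors h n hY
    have hZM : ∀ i ≤ t, Z i ∈ M (n + i) := by
      intro i hi
      have := hZ 0 i (Nat.zero_le _) hi
      rw [hZ0] at this
      exact D.descendants_subset (Set.singleton_subset_iff.2 hX) _ this
    -- What grows from `Z j` is transplanted to the earlier `Z i` of the same type. This shortens
    -- the chain by `j - i`, and induction applies.
    obtain ⟨i, j, hij, hj, -, hs⟩ := exists_sameType (G := G) hlen Z
      fun i hi => D.isHyperarc hG _ _ (hZM i (by omega))
    have husj : ∀ u ∈ us, u ∈ (Z j).2 := fun u hu =>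
      D.mem_of_mem_descendants hG (hZM j (by omega)) (hZ j t (by omega) le_rfl)
        (hZt ▸ husY u hu) (D.hyperVertices_mono hG (Nat.le_add_right _ _) ⟨X, hX, hus u hu⟩)
    obtain ⟨Y', hY', hs'⟩ := hs.exists_descendant hG D (hZM j (by omega)) (hZM i (by omega)) husj
      (hZt ▸ hZ j t (by omega) le_rfl)
    have hY'' : Y' ∈ G.descendants h n {X} (i + (t - j)) := by
      rw [descendants_add]
      refine descendants_mono h _ (Set.singleton_subset_iff.2 ?_) _ hY'
      simpa [hZ0] using hZ 0 i (Nat.zero_le _) (by omega)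
    obtain ⟨s, hsK, W, hW, hYW⟩ := ih _ (by omega) hY'' fun u hu => hs'.mem hu (husY u hu)
    exact ⟨s, hsK, W, hW, hs'.trans hYW⟩

theorem IsDerivation.exists_mem_descendants (D : G.IsDerivation M h) {n t : ℕ} (hnt : n ≤ t)
    {Y : Hyperarc} (hY : Y ∈ M t) : ∃ X ∈ M n, Y ∈ G.descendants h n {X} (t - n) := by
  refine (mem_descendants_iff h n (t - n)).1 ?_
  rwa [D.descendants_eq, Nat.add_sub_cancel' hnt]

/-- Terminal hyperarcs on given vertices of the generated graph appear early. -/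
theorem IsDerivation.exists_early_terminal (hG : G.IsValid) (D : G.IsDerivation M h)
    {us : List ℕ} (hlen : us.length ≤ 2) {n : ℕ} (hus : ∀ u ∈ us, u ∈ hyperVertices (M n))
    {Y : Hyperarc} (hY : Y ∈ limitGraph M) (husY : ∀ u ∈ us, u ∈ Y.2) :
    ∃ Y' ∈ terminalPart (M (n + G.typeBound)), SameType us Y Y' := by
  obtain ⟨t, ht⟩ := mem_limitGraph.1 hY
  have ht' := D.terminalPart_mono (le_max_right n t) ht
  obtain ⟨X, hX, hYX⟩ := D.exists_mem_descendants (le_max_left n t) ht'.1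
  obtain ⟨s, hs, Y', hY', hYY'⟩ := D.exists_early hG hlen hX
    (fun u hu => D.mem_of_mem_descendants hG hX hYX (husY u hu) (hus u hu)) hYX husY
  refine ⟨Y', D.terminalPart_mono (Nat.add_le_add_left hs n)
    ⟨D.descendants_subset (Set.singleton_subset_iff.2 hX) s hY', fun A => ?_⟩, hYY'⟩
  rw [← hYY'.label_eq]
  exact ht'.2 A

/-- A vertex may at first lie on non-terminals only, and it might never reach the generated graph.
Pumping down relative to `[v]` bounds the wait for a terminal hyperarc on it. -/
theorem IsDerivation.mem_hyperVertices_terminalPart (hG : G.IsValid) (D : G.IsDerivation M h)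
    {n v : ℕ} (hv : v ∈ hyperVertices (M n)) (hvH : v ∈ hyperVertices (limitGraph M)) :
    v ∈ hyperVertices (terminalPart (M (n + G.typeBound))) := by
  obtain ⟨Y, hY, hvY⟩ := hvH
  obtain ⟨Y', hY', hs⟩ := D.exists_early_terminal hG (us := [v]) (by simp) (by simpa) hY (by simpa)
  exact ⟨Y', hY', hs.mem (by simp) hvY⟩

/-- Relative to both of its ends, an arc is the only hyperarc of its type, so an early hyperarc of
that type is the arc itself. -/
theorem IsDerivation.arcTargets_limitGraph_inter (hG : G.IsValid) (D : G.IsDerivation M h)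
    {n v v' a : ℕ} (hv : v ∈ hyperVertices (M n)) (hv' : v' ∈ hyperVertices (M n))
    (ha : v' ∈ arcTargets (limitGraph M) v a) : v' ∈ arcTargets (M (n + G.typeBound)) v a := by
  obtain ⟨Y', hY', hs⟩ := D.exists_early_terminal hG (us := [v, v']) (n := n) (by simp)
    (by simp [hv, hv']) ha (by simp)
  rw [hs.eq_of_subset (by simp)] at hY'
  exact hY'.1

theorem arcTargets_mem_limitGraph {n v v' a : ℕ} (ha : v' ∈ arcTargets (M n) v a) :
    v' ∈ arcTargets (limitGraph M) v a :=
  mem_limitGraph.2 ⟨n, ha, fun _ => by simp⟩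

end IsDerivation

end HRGrammar

/-! ### Finiteness of the out-degrees and reduction to finitely many stages -/

namespace HRGrammar

variable {G : HRGrammar}

section IsDerivation

variable {M : ℕ → Set Hyperarc} {h : ℕ → ℕ → List ℕ → ℕ → ℕ}

theorem mem_hyperVertices_iUnion {M : ℕ → Set Hyperarc} {v : ℕ} :
    v ∈ hyperVertices (⋃ n, M n) ↔ ∃ n, v ∈ hyperVertices (M n) := by
  simp only [hyperVertices, Set.mem_ofPred_eq, Set.mem_iUnion]
  exact ⟨fun ⟨X, ⟨n, hX⟩, hv⟩ => ⟨n, X, hX, hv⟩, fun ⟨n, X, hX, hv⟩ => ⟨X, ⟨n, hX⟩, hv⟩⟩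

theorem exists_mem_hyperVertices {v : ℕ} (hv : v ∈ hyperVertices (limitGraph M)) :
    ∃ n, v ∈ hyperVertices (M n) :=
  mem_hyperVertices_iUnion.1 (_root_.hyperVertices_mono (limitGraph_subset_iUnion M) hv)

/-- Arcs from a vertex `v` to vertices outside `X`, born from a hyperarc `X`, have counterparts
for hyperarcs of the same type. -/
theorem SameType.exists_arcTarget (hG : G.IsValid) (D : G.IsDerivation M h) {v a : ℕ}
    {m n t : ℕ} {X X' : Hyperarc} (hX : X ∈ M m) (hX' : X' ∈ M n) (hXX' : SameType [v] X X')
    (hv : v ∈ X.2) {v' : ℕ} (hv' : v' ∉ X.2)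
    (ha : v' ∈ arcTargets (G.descendants h m {X} t) v a) :
    ∃ u ∈ arcTargets (limitGraph M) v a, u ∉ hyperVertices (M n) ∧
      ∀ s, v' ∈ hyperVertices (G.descendants h m {X} s) → u ∈ hyperVertices (M (n + s)) := by
  obtain ⟨φ, hφ, rfl, hfix⟩ := hXX'
  obtain ⟨Φ, hΦφ, hΦ⟩ := D.exists_extension_descendants hG hX hX' hφ
  have hΦv : Φ v = v := (hΦφ v hv).trans (hfix v (by simp))
  have DX := D.descendants hG (Set.singleton_subset_iff.2 hX)
  have hvt : v ∈ hyperVertices (G.descendants h m {X} t) := ⟨_, ha, by simp⟩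
  have hv't : v' ∈ hyperVertices (G.descendants h m {X} t) := ⟨_, ha, by simp⟩
  have hmem : Φ v' ∈ arcTargets (G.descendants h n {X.mapVertices φ} t) v a := by
    rw [(hΦ t).2, ← hΦv, arcTargets_image (hΦ t).1 hvt]
    exact Set.mem_image_of_mem _ ha
  refine ⟨Φ v', arcTargets_mem_limitGraph
    (D.descendants_subset (Set.singleton_subset_iff.2 hX') t hmem), ?_, ?_⟩
  · refine D.not_mem_hyperVertices hG (Set.singleton_subset_iff.2 hX')
      (arcTargets_subset_hyperVertices _ _ _ hmem) ?_
    rintro ⟨_, rfl, hu⟩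
    obtain ⟨u, hu, e⟩ := Hyperarc.mem_mapVertices.1 hu
    rw [← hΦφ u hu] at e
    have hut : u ∈ hyperVertices (G.descendants h m {X} t) :=
      DX.hyperVertices_mono hG (Nat.zero_le t) ⟨X, rfl, hu⟩
    exact hv' ((hΦ t).1 hut hv't e ▸ hu)
  · intro s hs
    refine _root_.hyperVertices_mono (D.descendants_subset (Set.singleton_subset_iff.2 hX') s) ?_
    rw [(hΦ s).2, hyperVertices_image]
    exact Set.mem_image_of_mem _ hs

/-- If a vertex has finitely many targets, then they are born early. -/
theorem IsDerivation.arcTargets_subset_of_finite (hG : G.IsValid) (D : G.IsDerivation M h)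
    {n v a : ℕ} (hv : v ∈ hyperVertices (M n)) (hfin : (arcTargets (limitGraph M) v a).Finite) :
    arcTargets (limitGraph M) v a ⊆ hyperVertices (M (n + G.typeBound)) := by
  intro v' hv'
  by_contra hnot
  obtain ⟨t, ht⟩ := mem_limitGraph.1 hv'
  set T := max (n + G.typeBound) t
  have hT : n + G.typeBound ≤ T := le_max_left _ _
  have hYT := (D.terminalPart_mono (le_max_right (n + G.typeBound) t) ht).1
  obtain ⟨X, hX, hY⟩ := D.exists_mem_descendants (show n ≤ T by omega) hYT
  obtain ⟨Z, hZ0, hZt, hZ⟩ := exists_ancestors h n hY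
  have hZM : ∀ i ≤ T - n, Z i ∈ M (n + i) := by
    intro i hi
    have := hZ 0 i (Nat.zero_le _) hi
    rw [hZ0] at this
    exact D.descendants_subset (Set.singleton_subset_iff.2 hX) _ this
  obtain ⟨i, j, hij, hj, hs, -⟩ := exists_sameType (G := G) (us := [v]) (by simp) Z
    fun i hi => D.isHyperarc hG _ _ (hZM i (by omega))
  have hYi : ∀ i ≤ T - n, (HRSymbol.arcLabel a, [v, v']) ∈
      G.descendants h (n + i) {Z i} (T - n - i) := fun i hi => hZt ▸ hZ i _ hi le_rfl
  have hvZ : ∀ i ≤ T - n, v ∈ (Z i).2 := fun i hi =>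
    D.mem_of_mem_descendants hG (hZM i hi) (hYi i hi) (by simp)
      (D.hyperVertices_mono hG (Nat.le_add_right _ _) hv)
  -- Since `i ≤ typeBound` and `v'` is born after stage `n + typeBound`, `v'` is new relative to `Z
  -- i`.
  have hv'Z : v' ∉ (Z i).2 := fun hm =>
    hnot (D.hyperVertices_mono hG (by omega) ⟨_, hZM i (by omega), hm⟩)
  -- Pumping up: `Z i` produces `Z j` of its own type, so this type recurs arbitrarily late. Each
  -- recurrence gives `v` a target that is new at that time, whereas finitely many targets would all
  -- be present at some stage `r`.
  have recur : ∀ r, ∃ m ≥ r, ∃ W ∈ M m, SameType [v] (Z i) W := by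
    intro r
    induction r with
    | zero => exact ⟨n + i, Nat.zero_le _, Z i, hZM i (by omega), SameType.refl _ _⟩
    | succ r ih =>
      obtain ⟨m, hm, W, hW, hsW⟩ := ih
      obtain ⟨W', hW', hs'⟩ := hsW.exists_descendant hG D (hZM i (by omega)) hW
        (by simpa using hvZ i (by omega)) (hZ i j hij.le (by omega))
      exact ⟨m + (j - i), by omega, W',
        D.descendants_subset (Set.singleton_subset_iff.2 hW) _ hW', hs.trans hs'⟩
  have bound : ∃ r, arcTargets (limitGraph M) v a ⊆ hyperVertices (M r) := by
    have hex : ∀ u ∈ arcTargets (limitGraph M) v a, ∃ r, u ∈ hyperVertices (M r) :=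
      fun u hu => exists_mem_hyperVertices (arcTargets_subset_hyperVertices _ _ _ hu)
    choose! r hr using hex
    exact ⟨hfin.toFinset.sup r, fun u hu =>
      D.hyperVertices_mono hG (Finset.le_sup (hfin.mem_toFinset.2 hu)) (hr u hu)⟩
  obtain ⟨r, hr⟩ := bound
  obtain ⟨m, hm, W, hW, hsW⟩ := recur r
  obtain ⟨u, hu, huM, -⟩ := hsW.exists_arcTarget hG D (hZM i (by omega)) hW (hvZ i (by omega))
    hv'Z (hYi i (by omega))
  exact huM (D.hyperVertices_mono hG hm (hr hu))

/-- If a vertex of `M n` has a target outside `M n`, then it has one that is born early. -/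
theorem IsDerivation.exists_early_arcTarget (hG : G.IsValid) (D : G.IsDerivation M h)
    {n v a : ℕ} (hv : v ∈ hyperVertices (M n))
    (hnot : ¬ arcTargets (limitGraph M) v a ⊆ hyperVertices (M n)) :
    ¬ arcTargets (M (n + 2 * G.typeBound + 1)) v a ⊆ hyperVertices (M n) := by
  obtain ⟨v', hv', hn⟩ := Set.not_subset.1 hnot
  -- The birth step of `v'`. Its ancestor `Z r` contains `v` but not `v'`, while `Z (r + 1)` already
  -- contains `v'`.
  obtain ⟨r, hr0, hr1⟩ : ∃ r, v' ∉ hyperVertices (M (n + r)) ∧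
      v' ∈ hyperVertices (M (n + (r + 1))) := by
    by_contra! hcon
    obtain ⟨t, ht⟩ := exists_mem_hyperVertices (arcTargets_subset_hyperVertices _ _ _ hv')
    have : ∀ r, v' ∉ hyperVertices (M (n + r)) := fun r => by
      induction r with
      | zero => exact hn
      | succ r ih => exact hcon r ih
    exact this t (D.hyperVertices_mono hG (Nat.le_add_left t n) ht)
  obtain ⟨t, ht⟩ := mem_limitGraph.1 hv'
  set T := max (n + r + 1) t
  have hT : n + r + 1 ≤ T := le_max_left _ _
  have hYT := (D.terminalPart_mono (le_max_right (n + r + 1) t) ht).1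
  obtain ⟨X, hX, hY⟩ := D.exists_mem_descendants (show n ≤ T by omega) hYT
  obtain ⟨Z, hZ0, hZt, hZ⟩ := exists_ancestors h n hY
  have hZM : ∀ i ≤ T - n, Z i ∈ M (n + i) := by
    intro i hi
    have := hZ 0 i (Nat.zero_le _) hi
    rw [hZ0] at this
    exact D.descendants_subset (Set.singleton_subset_iff.2 hX) _ this
  have hYi : ∀ i ≤ T - n, (HRSymbol.arcLabel a, [v, v']) ∈
      G.descendants h (n + i) {Z i} (T - n - i) := fun i hi => hZt ▸ hZ i _ hi le_rfl
  have hvZ : ∀ i ≤ T - n, v ∈ (Z i).2 := fun i hi =>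
    D.mem_of_mem_descendants hG (hZM i hi) (hYi i hi) (by simp)
      (D.hyperVertices_mono hG (Nat.le_add_right _ _) hv)
  have hv'Z : v' ∈ (Z (r + 1)).2 :=
    D.mem_of_mem_descendants hG (hZM (r + 1) (by omega)) (hYi _ (by omega)) (by simp) hr1
  have hZr := hZ 0 r (Nat.zero_le _) (by omega)
  rw [hZ0] at hZr
  obtain ⟨s, hs, W, hW, hsW⟩ := D.exists_early hG (us := [v]) (by simp) hX
    (by simpa [hZ0] using hvZ 0 (Nat.zero_le _)) hZr (by simpa using hvZ r (by omega))
  have hWM := D.descendants_subset (Set.singleton_subset_iff.2 hX) s hW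
  obtain ⟨u, hu, huM, hus⟩ := hsW.exists_arcTarget hG D (hZM r (by omega)) hWM (hvZ r (by omega))
    (fun hm => hr0 ⟨_, hZM r (by omega), hm⟩) (hYi r (by omega))
  -- The bound `2 * typeBound + 1` adds up as follows: at most `typeBound` steps until `W`, one step
  -- until `u` is born, and `typeBound` further steps until the arc from `v` to `u` is present.
  have hu1 := hus 1 ⟨_, by simpa using hZ r (r + 1) (by omega) (by omega), hv'Z⟩
  have hu2 := D.arcTargets_limitGraph_inter hG
    (D.hyperVertices_mono hG (by omega : n ≤ n + s + 1) hv) hu1 hu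
  intro hsub
  refine huM (D.hyperVertices_mono hG (Nat.le_add_right n s) (hsub ?_))
  exact (D.terminalPart_mono (by omega : n + s + 1 + G.typeBound ≤ n + 2 * G.typeBound + 1)
    ⟨hu2, fun _ => by simp⟩).1

/-- The hyperarcs on a vertex born from `X` are descendants of `X`. -/
theorem IsDerivation.mem_descendants_of_born (hG : G.IsValid) (D : G.IsDerivation M h)
    {n v : ℕ} {X : Hyperarc} (hX : X ∈ M n) (hv : v ∈ hyperVertices (G.descendants h n {X} 1))
    (hvM : v ∉ hyperVertices (M n)) {Y : Hyperarc} (hY : Y ∈ limitGraph M) (hvY : v ∈ Y.2) :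
    Y ∈ limitGraph (G.descendants h n {X}) := by
  obtain ⟨t, ht⟩ := mem_limitGraph.1 hY
  have ht' := D.terminalPart_mono (le_max_right (n + 1) t) ht
  obtain ⟨X', hX', hY'⟩ := D.exists_mem_descendants
    (show n ≤ max (n + 1) t from le_trans (Nat.le_succ n) (le_max_left _ _)) ht'.1
  -- The ancestor of `Y` at stage `n + 1` contains `v`, which exists by then. So `v` also arises
  -- from `X'`, and the disjointness of new vertices forces `X' = X`.
  have hv' : v ∈ hyperVertices (G.descendants h n {X'} 1) := by
    rw [show max (n + 1) t - n = 1 + (max (n + 1) t - (n + 1)) by omega, descendants_add,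
      mem_descendants_iff] at hY'
    obtain ⟨W, hW, hY'⟩ := hY'
    exact ⟨W, hW, D.mem_of_mem_descendants hG
      (D.descendants_subset (Set.singleton_subset_iff.2 hX') _ hW) hY' hvY
      (_root_.hyperVertices_mono (D.descendants_subset (Set.singleton_subset_iff.2 hX) _) hv)⟩
  have born : ∀ {X}, X ∈ M n → v ∈ hyperVertices (G.descendants h n {X} 1) →
      ∃ A vs, X = (HRSymbol.nonterminal A, vs) ∧ ∃ w ∈ G.innerVertices A, h n A vs w = v := by
    intro X hX hv
    rcases mem_hyperVertices_rewrite ((D.isRewriting n).anti (Set.singleton_subset_iff.2 hX)) hv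
      with hv | ⟨A, vs, hA, hw⟩
    · exact absurd (_root_.hyperVertices_mono (Set.singleton_subset_iff.2 hX) hv) hvM
    · exact ⟨A, vs, hA.symm, hw⟩
  obtain ⟨A, vs, rfl, w, hw, e⟩ := born hX hv
  obtain ⟨B, ws, rfl, u, hu, e'⟩ := born hX' hv'
  have hne : (A, vs) = (B, ws) := by
    by_contra hne
    exact ((D.isRewriting n).disj A vs B ws hX hX' hne).ne_of_mem
      ⟨w, hw, rfl⟩ ⟨u, hu, rfl⟩ (e.trans e'.symm)
  obtain ⟨rfl, rfl⟩ := Prod.mk.inj hne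
  exact mem_limitGraph.2 ⟨_, hY', ht'.2⟩

theorem IsDerivation.limitGraph_descendants_subset (D : G.IsDerivation M h) {n : ℕ}
    {S : Set Hyperarc} (hS : S ⊆ M n) : limitGraph (G.descendants h n S) ⊆ limitGraph M :=
  Set.iUnion_subset fun t _ hX =>
    mem_limitGraph.2 ⟨n + t, D.descendants_subset hS t hX.1, hX.2⟩

theorem IsDerivation.arcTargets_of_born (hG : G.IsValid) (D : G.IsDerivation M h)
    {n v : ℕ} {X : Hyperarc} (hX : X ∈ M n) (hv : v ∈ hyperVertices (G.descendants h n {X} 1))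
    (hvM : v ∉ hyperVertices (M n)) (a : ℕ) :
    arcTargets (limitGraph M) v a = arcTargets (limitGraph (G.descendants h n {X})) v a :=
  Set.Subset.antisymm
    (fun _ hu => D.mem_descendants_of_born hG hX hv hvM hu (by simp))
    (fun _ hu => D.limitGraph_descendants_subset (Set.singleton_subset_iff.2 hX) hu)

/-- A vertex with the same arcs appears early. -/
theorem IsDerivation.exists_early_vertex (hG : G.IsValid) (D : G.IsDerivation M h)
    {Z : Hyperarc} (h0 : M 0 = {Z}) (hZ : Z.2 = []) {v : ℕ}
    (hv : v ∈ hyperVertices (limitGraph M)) :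
    ∃ v' ∈ hyperVertices (limitGraph M), v' ∈ hyperVertices (M (G.typeBound + 1)) ∧
      ∃ Φ : ℕ → ℕ, ∀ a, Set.InjOn Φ (arcTargets (limitGraph M) v a) ∧
        arcTargets (limitGraph M) v' a = Φ '' arcTargets (limitGraph M) v a := by
  -- The initial hyperarc has no vertices, so `v` is born at a definite step.
  obtain ⟨n, hn0, hn1⟩ : ∃ n, v ∉ hyperVertices (M n) ∧ v ∈ hyperVertices (M (n + 1)) := by
    by_contra! hcon
    obtain ⟨t, ht⟩ := exists_mem_hyperVertices hv
    have : ∀ r, v ∉ hyperVertices (M r) := fun r => by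
      induction r with
      | zero => simp [h0, hyperVertices_singleton, hZ]
      | succ r ih => exact hcon r ih
    exact this t ht
  obtain ⟨Y, hY, hvY⟩ := hn1
  obtain ⟨X, hX, hYX⟩ := D.exists_mem_descendants (Nat.le_succ n) hY
  rw [Nat.succ_eq_add_one, Nat.add_sub_cancel_left] at hYX
  have hvX : v ∈ hyperVertices (G.descendants h n {X} 1) := ⟨Y, hYX, hvY⟩
  have hX0 : X ∈ G.descendants h 0 {Z} n := by
    rw [← h0, D.descendants_eq, Nat.zero_add]; exact hX
  -- The parent `X` of `v` has an isomorphic copy at some stage `s ≤ typeBound`, and the counterpart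
  -- of `v` is born one step later. All arcs at a vertex come from its parent, so the extended
  -- isomorphism matches them.
  obtain ⟨s, hs, X', hX', φ, hφ, rfl, -⟩ := D.exists_early hG (us := []) (by simp)
    (show Z ∈ M 0 by simp [h0]) (by simp) hX0 (by simp)
  have hX'M : X.mapVertices φ ∈ M s := by
    have := D.descendants_subset (show {Z} ⊆ M 0 by simp [h0]) s hX'
    rwa [Nat.zero_add] at this
  obtain ⟨Φ, hΦφ, hΦ⟩ := D.exists_extension_descendants hG hX hX'M hφ
  have DX := D.descendants hG (Set.singleton_subset_iff.2 hX)
  have hinj := (injOn_iUnion_hyperVertices hG DX fun t => (hΦ t).1).mono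
    (_root_.hyperVertices_mono (limitGraph_subset_iUnion _))
  have hlim := limitGraph_image fun t => (hΦ t).2
  obtain ⟨W, hW, hvW⟩ := hv
  have hvL : v ∈ hyperVertices (limitGraph (G.descendants h n {X})) :=
    ⟨W, D.mem_descendants_of_born hG hX hvX hn0 hW hvW, hvW⟩
  have hv'1 : Φ v ∈ hyperVertices (G.descendants h s {X.mapVertices φ} 1) := by
    rw [(hΦ 1).2, hyperVertices_image]
    exact Set.mem_image_of_mem _ hvX
  have hv'M : Φ v ∉ hyperVertices (M s) := by
    refine D.not_mem_hyperVertices hG (Set.singleton_subset_iff.2 hX'M) hv'1 ?_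
    rintro ⟨_, rfl, hu⟩
    obtain ⟨u, hu, e⟩ := Hyperarc.mem_mapVertices.1 hu
    rw [← hΦφ u hu] at e
    have hu1 : u ∈ hyperVertices (G.descendants h n {X} 1) :=
      DX.hyperVertices_mono hG (Nat.zero_le 1) ⟨X, rfl, hu⟩
    exact hn0 ⟨X, hX, (hΦ 1).1 hu1 hvX e ▸ hu⟩
  refine ⟨Φ v, ?_, ?_, Φ, fun a => ?_⟩
  · refine _root_.hyperVertices_mono
      (D.limitGraph_descendants_subset (Set.singleton_subset_iff.2 hX'M)) ?_
    rw [hlim, hyperVertices_image]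
    exact Set.mem_image_of_mem _ hvL
  · exact D.hyperVertices_mono hG (Nat.add_le_add_right hs 1)
      (_root_.hyperVertices_mono (D.descendants_subset (Set.singleton_subset_iff.2 hX'M) 1) hv'1)
  · rw [D.arcTargets_of_born hG hX hvX hn0, D.arcTargets_of_born hG hX'M hv'1 hv'M, hlim,
      arcTargets_image hinj hvL]
    exact ⟨hinj.mono (arcTargets_subset_hyperVertices _ _ _), rfl⟩

/-- At each vertex of `H` the numbers of outgoing arcs are finite and the weighted sum is `1`. -/
def HasUnitWeights {k : ℕ} (μ : Fin k → ℝ) (H : Set Hyperarc) : Prop :=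
  ∀ v ∈ hyperVertices H, (∀ a : Fin k, (arcTargets H v a).Finite) ∧
    ∑ a : Fin k, μ a * ((arcTargets H v a).ncard : ℝ) = 1

/-- The condition on a graph generated by `G` can be checked on early hypergraphs. -/
theorem IsDerivation.hasUnitWeights_iff (hG : G.IsValid) (D : G.IsDerivation M h)
    {Z : Hyperarc} (h0 : M 0 = {Z}) (hZ : Z.2 = []) (hfin : ∀ n, (M n).Finite) {k : ℕ}
    (μ : Fin k → ℝ) {N₁ N₂ N₃ : ℕ} (h₁ : N₁ = 2 * G.typeBound + 1) (h₂ : N₂ = N₁ + G.typeBound)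
    (h₃ : N₃ = N₂ + 2 * G.typeBound + 1) :
    HasUnitWeights μ (limitGraph M) ↔ ∀ v ∈ hyperVertices (terminalPart (M N₁)),
      (∀ a : Fin k, arcTargets (M N₃) v a ⊆ hyperVertices (M N₂)) ∧
        ∑ a : Fin k, μ a * ((arcTargets (M N₃) v a).ncard : ℝ) = 1 := by
  have hsub : ∀ v a, arcTargets (M N₃) v a ⊆ arcTargets (limitGraph M) v a :=
    fun v a u hu => arcTargets_mem_limitGraph hu
  -- Once all targets lie in `M N₂`, the arcs to them are present `typeBound` steps later, hence in
  -- `M N₃`, and counting there is exact.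
  have heq : ∀ v ∈ hyperVertices (M N₁), ∀ a,
      arcTargets (limitGraph M) v a ⊆ hyperVertices (M N₂) →
      arcTargets (M N₃) v a = arcTargets (limitGraph M) v a := by
    intro v hv a hs
    refine (hsub v a).antisymm fun u hu => ?_
    have := D.arcTargets_limitGraph_inter hG (D.hyperVertices_mono hG (by omega) hv) (hs hu) hu
    exact (D.terminalPart_mono (by omega : N₂ + G.typeBound ≤ N₃) ⟨this, fun _ => by simp⟩).1
  constructor
  · intro H v hv
    have hv1 := _root_.hyperVertices_mono (terminalPart_subset _) hv
    obtain ⟨H1, H2⟩ := H v (_root_.hyperVertices_mono (Set.subset_iUnion _ N₁) hv)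
    have hs : ∀ a : Fin k, arcTargets (limitGraph M) v a ⊆ hyperVertices (M N₂) := fun a =>
      h₂ ▸ D.arcTargets_subset_of_finite hG hv1 (H1 a)
    refine ⟨fun a => (hsub v a).trans (hs a), ?_⟩
    simpa only [heq v hv1 _ (hs _)] using H2
  · intro H v hv
    obtain ⟨v', hv', hv'M, Φ, hΦ⟩ := D.exists_early_vertex hG h0 hZ hv
    have hv'1 := D.mem_hyperVertices_terminalPart hG hv'M hv'
    rw [show G.typeBound + 1 + G.typeBound = N₁ by omega] at hv'1
    have hv'2 := _root_.hyperVertices_mono (terminalPart_subset _) hv'1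
    obtain ⟨H1, H2⟩ := H v' hv'1
    have hs : ∀ a : Fin k, arcTargets (limitGraph M) v' a ⊆ hyperVertices (M N₂) := by
      intro a
      -- If some target lay outside `M N₂`, then one would already be visible at stage `N₃ = N₂ + 2
      -- * typeBound + 1`, against the check.
      by_contra hnot
      exact D.exists_early_arcTarget hG (D.hyperVertices_mono hG (by omega) hv'2) hnot
        (h₃ ▸ H1 a)
    have hvfin : (hyperVertices (M N₂)).Finite := by
      have : hyperVertices (M N₂) = ⋃ X ∈ M N₂, {v | v ∈ X.2} := by
        ext; simp [hyperVertices]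
      rw [this]
      exact (hfin N₂).biUnion fun X _ => X.2.finite_toSet
    refine ⟨fun a => ?_, ?_⟩
    · refine Set.Finite.of_finite_image ?_ (hΦ a).1
      rw [← (hΦ a).2]
      exact hvfin.subset (hs a)
    · rw [← H2]
      refine Finset.sum_congr rfl fun a _ => ?_
      rw [heq v' hv'2 a (hs a), (hΦ a).2, (hΦ a).1.ncard_image]

theorem HasUnitWeights.image {k : ℕ} {μ : Fin k → ℝ} {H : Set Hyperarc} {Φ : ℕ → ℕ}
    (hΦ : Set.InjOn Φ (hyperVertices H)) (hH : HasUnitWeights μ H) :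
    HasUnitWeights μ (Hyperarc.mapVertices Φ '' H) := by
  intro v hv
  rw [hyperVertices_image] at hv
  obtain ⟨v, hv, rfl⟩ := hv
  simp only [arcTargets_image hΦ hv,
    (hΦ.mono (arcTargets_subset_hyperVertices _ _ _)).ncard_image]
  exact ⟨fun a => ((hH v hv).1 a).image _, (hH v hv).2⟩

theorem mem_generatedGraphs_iff (hG : G.IsValid) {H : Set Hyperarc} :
    H ∈ G.generatedGraphs ↔ ∃ M h, G.IsDerivation M h ∧
      M 0 = {(HRSymbol.nonterminal G.start, [])} ∧ H = limitGraph M := by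
  constructor
  · rintro ⟨M, h0, hM, rfl⟩
    simp only [parallelRewrites_iff] at hM
    choose h h1 h2 using hM
    refine ⟨M, h, ⟨?_, h1, h2⟩, h0, rfl⟩
    rw [h0]
    rintro _ rfl
    exact ⟨hG.start_mem, hG.start_arity.symm⟩
  · rintro ⟨M, h, D, h0, rfl⟩
    exact ⟨M, h0, fun n => parallelRewrites_iff.2 ⟨h n, D.isRewriting n, D.succ n⟩, rfl⟩

/-- It suffices to consider one of the graphs generated by `G`. -/
theorem IsDerivation.isProbabilistic_iff (hG : G.IsValid) (D : G.IsDerivation M h)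
    (h0 : M 0 = {(HRSymbol.nonterminal G.start, [])}) (μ : Fin G.arcLabels → ℝ) :
    G.IsProbabilistic μ ↔ (∀ a, μ a ∈ Set.Icc (0 : ℝ) 1) ∧ HasUnitWeights μ (limitGraph M) := by
  constructor
  · intro P
    have hM := (mem_generatedGraphs_iff hG).2 ⟨M, h, D, h0, rfl⟩
    exact ⟨P.weight_mem, fun v hv => ⟨P.finite_arcs _ hM v hv, P.sum_eq_one _ hM v hv⟩⟩
  · rintro ⟨hμ, hM⟩
    have all : ∀ H ∈ G.generatedGraphs, HasUnitWeights μ H := by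
      intro H hH
      obtain ⟨M', h', D', h0', rfl⟩ := (mem_generatedGraphs_iff hG).1 hH
      obtain ⟨Φ, -, hΦ⟩ := D.exists_extension hG D' (Set.injOn_id _)
        (by simp [h0, h0', Hyperarc.mapVertices])
      rw [limitGraph_image fun t => (hΦ t).2]
      exact hM.image ((injOn_iUnion_hyperVertices hG D fun t => (hΦ t).1).mono
        (_root_.hyperVertices_mono (limitGraph_subset_iUnion _)))
    exact ⟨hG, hμ, fun H hH v hv => (all H hH v hv).1, fun H hH v hv => (all H hH v hv).2⟩

end IsDerivation

end HRGrammar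

/-! ### Closure properties of decidable and primitive recursive predicates -/

theorem ComputablePred.and {α : Type*} [Primcodable α] {p q : α → Prop} (hp : ComputablePred p)
    (hq : ComputablePred q) : ComputablePred fun a => p a ∧ q a := by
  obtain ⟨f, hf, rfl⟩ := ComputablePred.computable_iff.1 hp
  obtain ⟨g, hg, rfl⟩ := ComputablePred.computable_iff.1 hq
  refine ComputablePred.computable_iff.2
    ⟨fun a => f a && g a, Primrec.and.to_comp.comp hf hg, ?_⟩
  simp

theorem ComputablePred.comp {α β : Type*} [Primcodable α] [Primcodable β] {p : β → Prop}
    (hp : ComputablePred p) {f : α → β} (hf : Computable f) : ComputablePred fun a => p (f a) := by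
  obtain ⟨g, hg, rfl⟩ := ComputablePred.computable_iff.1 hp
  exact ComputablePred.computable_iff.2 ⟨fun a => g (f a), hg.comp hf, rfl⟩

theorem ComputablePred.forall_mem_list {α : Type*} [Primcodable α] {p : α → Prop}
    (hp : ComputablePred p) : ComputablePred fun l : List α => ∀ x ∈ l, p x := by
  obtain ⟨f, hf, rfl⟩ := ComputablePred.computable_iff.1 hp
  -- The list is scanned by index, accumulating a conjunction; a position outside the list counts as
  -- `true`.
  have step : Computable₂ fun (l : List α) (t : ℕ × Bool) =>
      t.2 && ((l[t.1]?).map f).getD true :=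
    Primrec.and.to_comp.comp (Computable.snd.comp Computable.snd)
      (Computable.option_getD
        (Computable.option_map
          (Computable.list_getElem?.comp Computable.fst (Computable.fst.comp Computable.snd))
          (hf.comp Computable.snd))
        (Computable.const true))
  refine ComputablePred.computable_iff.2
    ⟨_, Computable.nat_rec Computable.list_length (Computable.const true) step, ?_⟩
  funext l
  have key : ∀ n, (Nat.rec true (fun i b => b && ((l[i]?).map f).getD true) n : Bool) = true ↔
      ∀ i < n, ∀ x, l[i]? = some x → f x = true := by
    intro n
    induction n with
    | zero => simp
    | succ n ih =>
      simp only [Bool.and_eq_true]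
      rw [ih]
      constructor
      · rintro ⟨h1, h2⟩ i hi x hx
        rcases Nat.lt_succ_iff_lt_or_eq.1 hi with hi | rfl
        · exact h1 i hi x hx
        · simpa [hx] using h2
      · intro H
        refine ⟨fun i hi => H i (by omega), ?_⟩
        cases hx : l[n]? with
        | none => rfl
        | some x => simpa using H n (by omega) x hx
  refine propext (Iff.trans ?_ (key l.length).symm)
  constructor
  · exact fun H i _ x hx => H x (List.mem_of_getElem? hx)
  · intro H x hx
    obtain ⟨i, hi, rfl⟩ := List.getElem_of_mem hx
    exact H i hi _ (List.getElem?_eq_getElem hi)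

theorem PrimrecRel.mem_list {α : Type*} [Primcodable α] :
    PrimrecRel fun (l : List α) (a : α) => a ∈ l :=
  (PrimrecRel.exists_mem_list (Primrec.eq (α := α))).of_eq fun l a => by simp

theorem PrimrecRel.forall_lt_nat {α : Type*} [Primcodable α] {R : ℕ → α → Prop}
    (hR : PrimrecRel R) : PrimrecRel fun (n : ℕ) (a : α) => ∀ i < n, R i a :=
  (hR.forall_mem_list.comp (Primrec.list_range.comp Primrec.fst) Primrec.snd).of_eq fun _ => by
    simp

theorem Primrec.list_nat_sum : Primrec (List.sum : List ℕ → ℕ) :=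
  (Primrec.list_foldr Primrec.id (Primrec.const 0)
    ((Primrec.nat_add.comp (Primrec.fst.comp Primrec.snd)
      (Primrec.snd.comp Primrec.snd)).to₂)).of_eq fun l => by
    induction l with
    | nil => rfl
    | cons x l ih => simpa using ih

/-- In a list without repetitions each entry is at its own first position. This turns the property
into an equality of two primitive recursive lists. -/
theorem nodup_iff_map_idxOf (l : List ℕ) :
    l.Nodup ↔ l.map (fun x => l.idxOf x) = List.range l.length := by
  constructor
  · intro h
    refine List.ext_getElem (by simp) fun i h1 h2 => ?_
    have hi : i < l.length := by simpa using h1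
    simp [h.idxOf_getElem i hi]
  · intro h
    refine List.Nodup.of_map (fun x => l.idxOf x) ?_
    rw [h]
    exact List.nodup_range

theorem PrimrecPred.list_nodup : PrimrecPred fun l : List ℕ => l.Nodup :=
  (Primrec.eq.comp
    (Primrec.list_map Primrec.id (Primrec.list_idxOf.comp Primrec.snd Primrec.fst).to₂)
    (Primrec.list_range.comp Primrec.list_length)).of_eq fun l => (nodup_iff_map_idxOf l).symm

/-! ### Finite hypergraphs as lists -/

theorem HRSymbol.primrec_equivSum : Primrec HRSymbol.equivSum := Primrec.of_equiv

theorem HRGrammar.primrec_equivProd : Primrec HRGrammar.equivProd := Primrec.of_equiv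

theorem HRSymbol.primrec_arcLabel : Primrec HRSymbol.arcLabel :=
  (Primrec.of_equiv_symm (e := HRSymbol.equivSum)).comp (Primrec.sumInr.comp Primrec.sumInl)

theorem HRSymbol.primrec_nonterminal : Primrec HRSymbol.nonterminal :=
  (Primrec.of_equiv_symm (e := HRSymbol.equivSum)).comp Primrec.sumInl

/-- The number of a non-terminal. -/
def HRSymbol.nonterminal? : HRSymbol → Option ℕ
  | HRSymbol.nonterminal A => some A
  | _ => none

theorem HRSymbol.primrec_nonterminal? : Primrec HRSymbol.nonterminal? :=
  (Primrec.sumCasesOn HRSymbol.primrec_equivSum (Primrec.option_some.comp Primrec.snd).to₂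
    (Primrec.const none).to₂).of_eq fun s => by cases s <;> rfl

/-- The list of the vertices of a finite hypergraph. -/
def vertexList (L : List Hyperarc) : List ℕ := L.flatMap fun X => X.2

theorem mem_vertexList {L : List Hyperarc} {v : ℕ} :
    v ∈ vertexList L ↔ v ∈ hyperVertices {X | X ∈ L} := by
  simp [vertexList, hyperVertices]

theorem primrec_vertexList : Primrec vertexList :=
  Primrec.list_flatMap Primrec.id (Primrec.snd.comp Primrec.snd).to₂

/-- A number that is larger than all vertices of a finite hypergraph. -/
def vertexBound (L : List Hyperarc) : ℕ := (vertexList L).sum + 1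

theorem lt_vertexBound {L : List Hyperarc} {v : ℕ} (hv : v ∈ hyperVertices {X | X ∈ L}) :
    v < vertexBound L :=
  Nat.lt_succ_of_le (List.single_le_sum (fun _ _ => Nat.zero_le _) _ (mem_vertexList.2 hv))

theorem primrec_vertexBound : Primrec vertexBound :=
  Primrec.succ.comp (Primrec.list_nat_sum.comp primrec_vertexList)

instance : DecidableEq HRSymbol := HRSymbol.equivSum.decidableEq

/-- The list of the terminal hyperarcs of a finite hypergraph. -/
def terminalList (L : List Hyperarc) : List Hyperarc :=
  L.filter fun X => X.1.nonterminal? = none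

theorem mem_terminalList {L : List Hyperarc} {X : Hyperarc} :
    X ∈ terminalList L ↔ X ∈ terminalPart {X | X ∈ L} := by
  obtain ⟨s, l⟩ := X
  cases s <;> simp [terminalList, terminalPart, HRSymbol.nonterminal?]

theorem primrec_terminalList : Primrec terminalList :=
  Primrec.listFilter (Primrec.eq.comp (HRSymbol.primrec_nonterminal?.comp Primrec.fst)
    (Primrec.const none))

/-- The list of the targets of the `a`-labelled arcs from `v` in a finite hypergraph. -/
def targetList (L : List Hyperarc) (v a : ℕ) : List ℕ :=
  (List.range (vertexBound L)).filterMap fun u =>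
    if (HRSymbol.arcLabel a, [v, u]) ∈ L then some u else none

theorem targetList_eq_filter (L : List Hyperarc) (v a : ℕ) :
    targetList L v a =
      (List.range (vertexBound L)).filter fun u => (HRSymbol.arcLabel a, [v, u]) ∈ L := by
  rw [← List.filterMap_eq_filter]
  refine List.filterMap_congr fun u _ => ?_
  simp [Option.guard]

theorem mem_targetList {L : List Hyperarc} {v a u : ℕ} :
    u ∈ targetList L v a ↔ u ∈ arcTargets {X | X ∈ L} v a := by
  rw [targetList_eq_filter, List.mem_filter, List.mem_range, decide_eq_true_eq]
  exact ⟨fun h => h.2, fun h => ⟨lt_vertexBound ⟨_, h, by simp⟩, h⟩⟩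

/-- The targets are selected from a range of numbers and so are listed once each, even if `L`
repeats an arc. -/
theorem length_targetList (L : List Hyperarc) (v a : ℕ) :
    (targetList L v a).length = (arcTargets {X | X ∈ L} v a).ncard := by
  have hn : (targetList L v a).Nodup := by
    rw [targetList_eq_filter]
    exact List.nodup_range.filter _
  rw [← List.toFinset_card_of_nodup hn, ← Set.ncard_coe_finset]
  congr 1
  ext u
  simp [mem_targetList]

theorem primrec_targetList :
    Primrec fun t : List Hyperarc × ℕ × ℕ => targetList t.1 t.2.1 t.2.2 := by
  have hv : Primrec fun p : (List Hyperarc × ℕ × ℕ) × ℕ => p.1.2.1 :=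
    Primrec.fst.comp (Primrec.snd.comp Primrec.fst)
  have ha : Primrec fun p : (List Hyperarc × ℕ × ℕ) × ℕ => p.1.2.2 :=
    Primrec.snd.comp (Primrec.snd.comp Primrec.fst)
  have hX : Primrec fun p : (List Hyperarc × ℕ × ℕ) × ℕ =>
      ((HRSymbol.arcLabel p.1.2.2, [p.1.2.1, p.2]) : Hyperarc) :=
    (HRSymbol.primrec_arcLabel.comp ha).pair
      (Primrec.list_cons.comp hv (Primrec.list_cons.comp Primrec.snd (Primrec.const [])))
  exact Primrec.listFilterMap (Primrec.list_range.comp (primrec_vertexBound.comp Primrec.fst))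
    (Primrec.ite (PrimrecRel.mem_list.comp (Primrec.fst.comp Primrec.fst) hX)
      (Primrec.option_some.comp Primrec.snd) (Primrec.const none)).to₂

/-! ### Grammars: primitive recursive bounds and decidable validity -/

namespace HRGrammar

theorem primrec_rules : Primrec HRGrammar.rules := Primrec.fst.comp primrec_equivProd

theorem primrec_arcLabels : Primrec HRGrammar.arcLabels :=
  Primrec.fst.comp (Primrec.snd.comp primrec_equivProd)

theorem primrec_colours : Primrec HRGrammar.colours :=
  Primrec.fst.comp (Primrec.snd.comp (Primrec.snd.comp primrec_equivProd))

theorem primrec_start : Primrec HRGrammar.start :=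
  Primrec.snd.comp (Primrec.snd.comp (Primrec.snd.comp primrec_equivProd))

/-- The list of the hyperarcs of `H_A`. -/
def rhsList (G : HRGrammar) (A : ℕ) : List Hyperarc := (G.rules.getD A ([], [])).1

theorem primrec_rhsList : Primrec₂ rhsList :=
  Primrec.fst.comp
    ((Primrec.list_getD ([], [])).comp (primrec_rules.comp Primrec.fst) Primrec.snd)

theorem primrec_inputs : Primrec₂ inputs :=
  Primrec.snd.comp
    ((Primrec.list_getD ([], [])).comp (primrec_rules.comp Primrec.fst) Primrec.snd)

theorem primrec_arity : Primrec₂ arity := Primrec.list_length.comp primrec_inputs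

theorem primrec_symbolBound : Primrec symbolBound :=
  Primrec.nat_add.comp (Primrec.nat_add.comp (Primrec.list_length.comp primrec_rules)
    primrec_arcLabels) primrec_colours

theorem primrec_lengthBound : Primrec lengthBound :=
  Primrec.nat_add.comp (Primrec.const 2) (Primrec.list_nat_sum.comp
    (Primrec.list_map primrec_rules
      (Primrec.list_length.comp (Primrec.snd.comp Primrec.snd)).to₂))

theorem primrec_typeBound : Primrec typeBound := by
  have hq : Primrec fun G : HRGrammar => G.lengthBound + 2 :=
    Primrec.nat_add.comp primrec_lengthBound (Primrec.const 2)
  have hpow : Primrec₂ fun m n : ℕ => m ^ n := Primrec₂.unpaired'.1 Nat.Primrec.pow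
  exact Primrec.nat_mul.comp primrec_symbolBound
    (hpow.comp (Primrec.const 2) (Primrec.nat_mul.comp hq hq))

theorem primrecRel_isHyperarc : PrimrecRel IsHyperarc := by
  have hl : Primrec fun p : (HRGrammar × Hyperarc) => p.2.2.length :=
    Primrec.list_length.comp (Primrec.snd.comp Primrec.snd)
  have h1 : PrimrecPred fun t : (HRGrammar × Hyperarc) × ℕ =>
      t.2 < t.1.1.rules.length ∧ t.1.2.2.length = t.1.1.arity t.2 :=
    (Primrec.nat_lt.comp Primrec.snd
      (Primrec.list_length.comp (primrec_rules.comp (Primrec.fst.comp Primrec.fst)))).and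
    (Primrec.eq.comp (hl.comp Primrec.fst)
      (primrec_arity.comp (Primrec.fst.comp Primrec.fst) Primrec.snd))
  have h2 : PrimrecPred fun t : (HRGrammar × Hyperarc) × ℕ =>
      t.2 < t.1.1.arcLabels ∧ t.1.2.2.length = 2 :=
    (Primrec.nat_lt.comp Primrec.snd
      (primrec_arcLabels.comp (Primrec.fst.comp Primrec.fst))).and
    (Primrec.eq.comp (hl.comp Primrec.fst) (Primrec.const 2))
  have h3 : PrimrecPred fun t : (HRGrammar × Hyperarc) × ℕ =>
      t.2 < t.1.1.colours ∧ t.1.2.2.length = 1 :=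
    (Primrec.nat_lt.comp Primrec.snd
      (primrec_colours.comp (Primrec.fst.comp Primrec.fst))).and
    (Primrec.eq.comp (hl.comp Primrec.fst) (Primrec.const 1))
  classical
  have hs : Primrec fun p : HRGrammar × Hyperarc => HRSymbol.equivSum p.2.1 :=
    HRSymbol.primrec_equivSum.comp (Primrec.fst.comp Primrec.snd)
  refine Primrec.primrecPred ((Primrec.sumCasesOn hs h1.decide.to₂
    (Primrec.sumCasesOn (f := fun q : (HRGrammar × Hyperarc) × (ℕ ⊕ ℕ) => q.2)
      (g := fun q a => decide (a < q.1.1.arcLabels ∧ q.1.2.2.length = 2))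
      (h := fun q c => decide (c < q.1.1.colours ∧ q.1.2.2.length = 1)) Primrec.snd
      (h2.decide.comp ((Primrec.fst.comp Primrec.fst).pair Primrec.snd)).to₂
      (h3.decide.comp ((Primrec.fst.comp Primrec.fst).pair Primrec.snd)).to₂).to₂).of_eq ?_)
  rintro ⟨G, s, l⟩
  rw [Bool.eq_iff_iff]
  cases s <;> simp [HRSymbol.equivSum, IsHyperarc] <;> exact (@decide_eq_true_iff _ (_)).symm

theorem isValid_iff (G : HRGrammar) : G.IsValid ↔ G.start < G.rules.length ∧
    G.arity G.start = 0 ∧ ∀ A < G.rules.length, (∀ X ∈ G.rhsList A, G.IsHyperarc X) ∧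
      (G.inputs A).Nodup ∧ ∀ v ∈ G.inputs A, v ∈ vertexList (G.rhsList A) := by
  have hmem : ∀ A v, v ∈ vertexList (G.rhsList A) ↔ v ∈ hyperVertices (G.rhs A) :=
    fun A v => mem_vertexList
  simp only [hmem]
  exact ⟨fun h => ⟨h.1, h.2, fun A hA => ⟨h.3 A hA, h.4 A hA, h.5 A hA⟩⟩,
    fun ⟨h1, h2, h⟩ => ⟨h1, h2, fun A hA => (h A hA).1, fun A hA => (h A hA).2.1,
      fun A hA => (h A hA).2.2⟩⟩

theorem primrecPred_isValid : PrimrecPred IsValid := by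
  have hlen : Primrec fun G : HRGrammar => G.rules.length :=
    Primrec.list_length.comp primrec_rules
  have hrhs : Primrec fun p : ℕ × HRGrammar => p.2.rhsList p.1 :=
    primrec_rhsList.comp Primrec.snd Primrec.fst
  have hinp : Primrec fun p : ℕ × HRGrammar => p.2.inputs p.1 :=
    primrec_inputs.comp Primrec.snd Primrec.fst
  have hA : PrimrecRel fun (A : ℕ) (G : HRGrammar) =>
      (∀ X ∈ G.rhsList A, G.IsHyperarc X) ∧
      (G.inputs A).Nodup ∧ ∀ v ∈ G.inputs A, v ∈ vertexList (G.rhsList A) :=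
    (primrecRel_isHyperarc.swap.forall_mem_list.comp hrhs Primrec.snd).and
      ((PrimrecPred.list_nodup.comp hinp).and
        (PrimrecRel.mem_list.swap.forall_mem_list.comp hinp (primrec_vertexList.comp hrhs)))
  have hall := hA.forall_lt_nat
  have har : PrimrecPred fun G : HRGrammar => G.arity G.start = 0 :=
    Primrec.eq.comp (primrec_arity.comp Primrec.id primrec_start) (Primrec.const 0)
  exact ((Primrec.nat_lt.comp primrec_start hlen).and (har.and (hall.comp hlen Primrec.id))).of_eq
    fun G => G.isValid_iff.symm

end HRGrammar

/-! ### Simulation of one derivation and the decision procedure -/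

namespace HRGrammar

/-- The vertex of a simulated rewriting that corresponds to the vertex `w` of `H_A`. -/
def simVertex (G : HRGrammar) (b A : ℕ) (vs : List ℕ) (w : ℕ) : ℕ :=
  (vs[(G.inputs A).idxOf w]?).getD (b + Nat.pair (Encodable.encode (A, vs)) w)

/-- The complete parallel rewriting of a finite hypergraph. -/
def simStep (G : HRGrammar) (L : List Hyperarc) : List Hyperarc :=
  terminalList L ++ L.flatMap fun X => (X.1.nonterminal?.map fun A =>
    (G.rhsList A).map (Hyperarc.mapVertices (G.simVertex (vertexBound L) A X.2))).getD []

/-- The hypergraph obtained after `n` complete parallel rewritings. -/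
def simulate (G : HRGrammar) (n : ℕ) : List Hyperarc :=
  Nat.rec [(HRSymbol.nonterminal G.start, [])] (fun _ L => G.simStep L) n

theorem primrec_simVertex : Primrec fun t : (HRGrammar × ℕ) × (ℕ × List ℕ) × ℕ =>
    t.1.1.simVertex t.1.2 t.2.1.1 t.2.1.2 t.2.2 := by
  have hA : Primrec fun t : (HRGrammar × ℕ) × (ℕ × List ℕ) × ℕ => t.2.1.1 :=
    Primrec.fst.comp (Primrec.fst.comp Primrec.snd)
  have hvs : Primrec fun t : (HRGrammar × ℕ) × (ℕ × List ℕ) × ℕ => t.2.1.2 :=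
    Primrec.snd.comp (Primrec.fst.comp Primrec.snd)
  have hw : Primrec fun t : (HRGrammar × ℕ) × (ℕ × List ℕ) × ℕ => t.2.2 :=
    Primrec.snd.comp Primrec.snd
  exact Primrec.option_getD.comp
    (Primrec.list_getElem?.comp hvs (Primrec.list_idxOf.comp hw
      (primrec_inputs.comp (Primrec.fst.comp Primrec.fst) hA)))
    (Primrec.nat_add.comp (Primrec.snd.comp Primrec.fst)
      (Primrec₂.natPair.comp (Primrec.encode.comp (Primrec.fst.comp Primrec.snd)) hw))

theorem primrec_simStep : Primrec₂ simStep := by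
  have hmap : Primrec fun t : (((HRGrammar × List Hyperarc) × Hyperarc) × ℕ) × Hyperarc =>
      t.2.mapVertices
        (t.1.1.1.1.simVertex (vertexBound t.1.1.1.2) t.1.2 t.1.1.2.2) := by
    refine Primrec.pair (Primrec.fst.comp Primrec.snd)
      (Primrec.list_map (Primrec.snd.comp Primrec.snd)
        (primrec_simVertex.comp (?_ : Primrec fun p : ((((HRGrammar × List Hyperarc) × Hyperarc) ×
          ℕ) × Hyperarc) × ℕ => ((p.1.1.1.1.1, vertexBound p.1.1.1.1.2),
            (p.1.1.2, p.1.1.1.2.2), p.2))).to₂)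
    have h1 : Primrec fun p : ((((HRGrammar × List Hyperarc) × Hyperarc) × ℕ) × Hyperarc) × ℕ =>
      p.1.1.1 := Primrec.fst.comp (Primrec.fst.comp Primrec.fst)
    exact ((Primrec.fst.comp (Primrec.fst.comp h1)).pair
      (primrec_vertexBound.comp (Primrec.snd.comp (Primrec.fst.comp h1)))).pair
      (((Primrec.snd.comp (Primrec.fst.comp Primrec.fst)).pair
        (Primrec.snd.comp (Primrec.snd.comp h1))).pair Primrec.snd)
  have hrhs : Primrec fun t : ((HRGrammar × List Hyperarc) × Hyperarc) × ℕ =>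
      t.1.1.1.rhsList t.2 :=
    primrec_rhsList.comp (Primrec.fst.comp (Primrec.fst.comp Primrec.fst)) Primrec.snd
  have hX : Primrec fun t : (HRGrammar × List Hyperarc) × Hyperarc => t.2.1.nonterminal? :=
    HRSymbol.primrec_nonterminal?.comp (Primrec.fst.comp Primrec.snd)
  exact Primrec.list_append.comp (primrec_terminalList.comp Primrec.snd)
    (Primrec.list_flatMap Primrec.snd (Primrec.option_getD.comp
      (Primrec.option_map hX (Primrec.list_map hrhs hmap.to₂).to₂) (Primrec.const [])).to₂)

theorem primrec_simulate : Primrec₂ simulate :=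
  Primrec.nat_rec
    (Primrec.list_cons.comp ((HRSymbol.primrec_nonterminal.comp primrec_start).pair
      (Primrec.const [])) (Primrec.const []))
    (primrec_simStep.comp Primrec.fst (Primrec.snd.comp Primrec.snd)).to₂

variable {G : HRGrammar}

theorem setOf_mem_simStep (G : HRGrammar) (L : List Hyperarc) :
    {X | X ∈ G.simStep L} = G.rewrite (G.simVertex (vertexBound L)) {X | X ∈ L} := by
  ext Y
  simp only [simStep, rewrite, Set.mem_ofPred_eq, List.mem_append, List.mem_flatMap,
    Set.mem_union, mem_terminalList]
  refine or_congr Iff.rfl ?_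
  constructor
  · rintro ⟨⟨s, vs⟩, hX, hY⟩
    cases s with
    | nonterminal A =>
      obtain ⟨X, hX', rfl⟩ := List.mem_map.1 hY
      exact ⟨A, vs, hX, X, hX', rfl⟩
    | _ => simp [HRSymbol.nonterminal?] at hY
  · rintro ⟨A, vs, hA, X, hX, rfl⟩
    exact ⟨_, hA, List.mem_map.2 ⟨X, hX, rfl⟩⟩

theorem isRewriting_simVertex (hG : G.IsValid) {L : List Hyperarc}
    (hL : ∀ X ∈ L, G.IsHyperarc X) :
    G.IsRewriting (G.simVertex (vertexBound L)) {X | X ∈ L} := by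
  have hnew : ∀ A vs, (HRSymbol.nonterminal A, vs) ∈ L → ∀ w ∈ G.innerVertices A,
      G.simVertex (vertexBound L) A vs w =
        vertexBound L + Nat.pair (Encodable.encode (A, vs)) w := by
    intro A vs hA w hw
    have hlen : vs.length = (G.inputs A).length := (hL _ hA).2
    -- For a vertex that is not an input, `idxOf` returns the number of inputs, which is the length
    -- of `vs`. The lookup fails and the default, a fresh vertex, is used.
    rw [simVertex, List.idxOf_eq_length hw.2, List.getElem?_eq_none hlen.le]
    rfl
  refine ⟨fun A vs hA => ⟨?_, ?_, ?_⟩, ?_⟩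
  · have hlen : vs.length = (G.inputs A).length := (hL _ hA).2
    refine List.ext_getElem (by simp [hlen]) fun i h1 h2 => ?_
    have hi : i < (G.inputs A).length := by simpa using h1
    simp [simVertex, (hG.inputs_injective A (hL _ hA).1).idxOf_getElem i hi, h2]
  · intro w hw u hu e
    rw [hnew A vs hA w hw, hnew A vs hA u hu] at e
    exact (Nat.pair_eq_pair.1 (Nat.add_left_cancel e)).2
  · intro w hw hm
    rw [hnew A vs hA w hw] at hm
    have := lt_vertexBound hm
    omega
  · intro A vs B ws hA hB hne
    -- The name of a new vertex encodes the hyperarc `(A, vs)` that it comes from.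
    rw [Set.disjoint_left]
    rintro _ ⟨w, hw, rfl⟩ ⟨u, hu, e⟩
    rw [hnew A vs hA w hw, hnew B ws hB u hu] at e
    exact hne (Encodable.encode_injective (Nat.pair_eq_pair.1 (Nat.add_left_cancel e)).1).symm

/-- The simulation is a derivation. -/
theorem isDerivation_simulate (hG : G.IsValid) :
    G.IsDerivation (fun n => {X | X ∈ G.simulate n})
      (fun n => G.simVertex (vertexBound (G.simulate n))) := by
  have h0 : ∀ X ∈ G.simulate 0, G.IsHyperarc X := by
    intro X hX
    obtain rfl := List.mem_singleton.1 hX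
    exact ⟨hG.start_mem, hG.start_arity.symm⟩
  have hsucc : ∀ n, {X | X ∈ G.simulate (n + 1)} =
      G.rewrite (G.simVertex (vertexBound (G.simulate n))) {X | X ∈ G.simulate n} :=
    fun n => setOf_mem_simStep G (G.simulate n)
  have hgood : ∀ n, ∀ X ∈ G.simulate n, G.IsHyperarc X := by
    intro n
    induction n with
    | zero => exact h0
    | succ n ih =>
      intro X hX
      exact IsHyperarc.rewrite hG ih X (hsucc n ▸ (show X ∈ {X | X ∈ G.simulate (n + 1)} from hX))
  exact ⟨h0, fun n => isRewriting_simVertex hG (hgood n), hsucc⟩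

/-- The stage of the simulation that contains vertices with all possible sets of arcs. -/
def stage₁ (G : HRGrammar) : List Hyperarc := G.simulate (2 * G.typeBound + 1)

/-- The stage of the simulation up to which the targets of early vertices are born. -/
def stage₂ (G : HRGrammar) : List Hyperarc := G.simulate (3 * G.typeBound + 1)

/-- The stage of the simulation at which the targets of early vertices are counted. -/
def stage₃ (G : HRGrammar) : List Hyperarc := G.simulate (5 * G.typeBound + 2)

theorem primrec_simulate_typeBound (c d : ℕ) :
    Primrec fun G : HRGrammar => G.simulate (c * G.typeBound + d) :=
  primrec_simulate.comp Primrec.id (Primrec.nat_add.comp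
    (Primrec.nat_mul.comp (Primrec.const c) primrec_typeBound) (Primrec.const d))

theorem primrec_stage₁ : Primrec stage₁ := primrec_simulate_typeBound 2 1

theorem primrec_stage₂ : Primrec stage₂ := primrec_simulate_typeBound 3 1

theorem primrec_stage₃ : Primrec stage₃ := primrec_simulate_typeBound 5 2

/-- The numbers of the targets of a vertex together with the weights of the labels. -/
def weightList {K : Type} (L : List Hyperarc) (μ : List K) (v : ℕ) : List (ℕ × K) :=
  (List.range μ.length).filterMap fun a => μ[a]?.map fun k => ((targetList L v a).length, k)

theorem weightList_eq_ofFn {K : Type} (L : List Hyperarc) (μ : List K) (v : ℕ) :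
    weightList L μ v =
      List.ofFn fun a : Fin μ.length => ((targetList L v a).length, μ.get a) := by
  have : weightList L μ v = ((List.finRange μ.length).map Fin.val).filterMap fun a =>
      μ[a]?.map fun k => ((targetList L v a).length, k) := by
    rw [List.map_coe_finRange_eq_range]; rfl
  rw [this, List.filterMap_map, List.ofFn_eq_map, ← List.filterMap_eq_map]
  refine List.filterMap_congr fun a _ => ?_
  simp

theorem primrec_weightList {K : Type} [Primcodable K] :
    Primrec fun t : (List Hyperarc × List K) × ℕ => weightList t.1.1 t.1.2 t.2 := by
  have hμ : Primrec fun t : (List Hyperarc × List K) × ℕ => t.1.2 := Primrec.snd.comp Primrec.fst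
  have hn : Primrec fun q : (((List Hyperarc × List K) × ℕ) × ℕ) × K =>
      (targetList q.1.1.1.1 q.1.1.2 q.1.2).length :=
    Primrec.list_length.comp (primrec_targetList.comp
      ((Primrec.fst.comp (Primrec.fst.comp (Primrec.fst.comp Primrec.fst))).pair
        ((Primrec.snd.comp (Primrec.fst.comp Primrec.fst)).pair (Primrec.snd.comp Primrec.fst))))
  exact Primrec.listFilterMap (Primrec.list_range.comp (Primrec.list_length.comp hμ))
    (Primrec.option_map (Primrec.list_getElem?.comp (hμ.comp Primrec.fst) Primrec.snd)
      (hn.pair Primrec.snd).to₂).to₂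

/-- The first group of conditions is purely combinatorial and primitive recursive. Only the last two
involve `val`, each in a form that one of the two assumed decision procedures answers. -/
theorem isPHRInstance_iff {K : Type} (val : K → ℝ) (G : HRGrammar) (μ : List K) :
    IsPHRInstance val (G, μ) ↔
      (μ.length = G.arcLabels ∧ G.IsValid ∧
        ∀ v ∈ vertexList (terminalList G.stage₁), ∀ a < G.arcLabels,
          ∀ u ∈ targetList G.stage₃ v a, u ∈ vertexList G.stage₂) ∧
      (∀ k ∈ μ, val k ∈ Set.Icc (0 : ℝ) 1) ∧
      ∀ l ∈ (vertexList (terminalList G.stage₁)).map (weightList G.stage₃ μ),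
        (l.map fun t => (t.1 : ℝ) * val t.2).sum = 1 := by
  by_cases hlen : μ.length = G.arcLabels
  swap
  · exact ⟨fun h => absurd h.1 hlen, fun h => absurd h.1.1 hlen⟩
  by_cases hG : G.IsValid
  swap
  · exact ⟨fun ⟨_, h⟩ => absurd h.valid hG, fun h => absurd h.1.2.1 hG⟩
  have D := isDerivation_simulate hG
  have h0 : {X | X ∈ G.simulate 0} = {(HRSymbol.nonterminal G.start, [])} := by
    ext
    simp [simulate]
  have hiff := D.isProbabilistic_iff hG h0 (fun a => val (μ.get (Fin.cast hlen.symm a)))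
  rw [D.hasUnitWeights_iff hG h0 rfl (fun n => List.finite_toSet _) _ rfl rfl rfl,
    show 2 * G.typeBound + 1 + G.typeBound = 3 * G.typeBound + 1 by ring,
    show 3 * G.typeBound + 1 + 2 * G.typeBound + 1 = 5 * G.typeBound + 2 by ring] at hiff
  have hinst : IsPHRInstance val (G, μ) ↔
      G.IsProbabilistic fun a => val (μ.get (Fin.cast hlen.symm a)) :=
    ⟨fun ⟨_, H⟩ => H, fun H => ⟨hlen, H⟩⟩
  rw [hinst, hiff]
  have hv₁ : ∀ v, v ∈ vertexList (terminalList G.stage₁) ↔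
      v ∈ hyperVertices (terminalPart {X | X ∈ G.simulate (2 * G.typeBound + 1)}) := by
    intro v
    rw [mem_vertexList]
    simp only [mem_terminalList]
    rfl
  have hv₂ : ∀ v, v ∈ vertexList G.stage₂ ↔
      v ∈ hyperVertices {X | X ∈ G.simulate (3 * G.typeBound + 1)} := fun v => mem_vertexList
  have ht : ∀ v a u, u ∈ targetList G.stage₃ v a ↔
      u ∈ arcTargets {X | X ∈ G.simulate (5 * G.typeBound + 2)} v a :=
    fun v a u => mem_targetList
  have hsum : ∀ v, ((weightList G.stage₃ μ v).map fun t => (t.1 : ℝ) * val t.2).sum =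
      ∑ a : Fin G.arcLabels, val (μ.get (Fin.cast hlen.symm a)) *
        ((arcTargets {X | X ∈ G.simulate (5 * G.typeBound + 2)} v a).ncard : ℝ) := by
    intro v
    rw [weightList_eq_ofFn, List.map_ofFn, List.sum_ofFn]
    refine Fintype.sum_equiv (finCongr hlen) _ _ fun a => ?_
    simp only [Function.comp_apply, length_targetList, stage₃]
    exact mul_comm _ _
  simp only [List.forall_mem_map, hv₁, hv₂, hsum, ht]
  constructor
  · rintro ⟨h1, h2⟩
    refine ⟨⟨hlen, hG, fun v hv a ha u hu => (h2 v hv).1 ⟨a, ha⟩ hu⟩, fun k hk => ?_,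
      fun v hv => (h2 v hv).2⟩
    obtain ⟨a, rfl⟩ := List.get_of_mem hk
    exact h1 (Fin.cast hlen a)
  · rintro ⟨⟨-, -, h1⟩, h2, h3⟩
    exact ⟨fun a => h2 _ (List.get_mem _ _), fun v hv =>
      ⟨fun a u hu => h1 v hv a a.2 u hu, h3 v hv⟩⟩

theorem primrecPred_targets_subset {f₁ f₂ f₃ : HRGrammar → List Hyperarc} (h₁ : Primrec f₁)
    (h₂ : Primrec f₂) (h₃ : Primrec f₃) : PrimrecPred fun G : HRGrammar =>
      ∀ v ∈ vertexList (terminalList (f₁ G)), ∀ a < G.arcLabels,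
        ∀ u ∈ targetList (f₃ G) v a, u ∈ vertexList (f₂ G) := by
  have hp : Primrec fun p : ℕ × ℕ × HRGrammar => (f₃ p.2.2, p.2.1, p.1) :=
    (h₃.comp (Primrec.snd.comp Primrec.snd)).pair
      ((Primrec.fst.comp Primrec.snd).pair Primrec.fst)
  have ht : Primrec fun p : ℕ × ℕ × HRGrammar => targetList (f₃ p.2.2) p.2.1 p.1 :=
    primrec_targetList.comp hp
  have hl : Primrec fun p : ℕ × ℕ × HRGrammar => vertexList (f₂ p.2.2) :=
    primrec_vertexList.comp (h₂.comp (Primrec.snd.comp Primrec.snd))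
  have hin : PrimrecRel fun (a : ℕ) (q : ℕ × HRGrammar) =>
      ∀ u ∈ targetList (f₃ q.2) q.1 a, u ∈ vertexList (f₂ q.2) :=
    PrimrecRel.mem_list.swap.forall_mem_list.comp ht hl
  have hmid : PrimrecRel fun (v : ℕ) (G : HRGrammar) => ∀ a < G.arcLabels,
      ∀ u ∈ targetList (f₃ G) v a, u ∈ vertexList (f₂ G) :=
    hin.forall_lt_nat.comp (primrec_arcLabels.comp Primrec.snd) Primrec.id
  exact hmid.forall_mem_list.comp
    (primrec_vertexList.comp (primrec_terminalList.comp h₁)) Primrec.id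

theorem computablePred_isPHRInstance {K : Type} [Primcodable K] {val : K → ℝ}
    (hmem : ComputablePred fun k : K => val k ∈ Set.Icc (0 : ℝ) 1)
    (hsum : ComputablePred fun l : List (ℕ × K) =>
      (l.map (fun t => (t.1 : ℝ) * val t.2)).sum = 1) :
    ComputablePred fun p : HRGrammar × List K => IsPHRInstance val p := by
  have hlen : PrimrecPred fun p : HRGrammar × List K => p.2.length = p.1.arcLabels :=
    Primrec.eq.comp (Primrec.list_length.comp Primrec.snd) (primrec_arcLabels.comp Primrec.fst)
  have hG := hlen.and ((primrecPred_isValid.comp Primrec.fst).and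
    ((primrecPred_targets_subset primrec_stage₁ primrec_stage₂ primrec_stage₃).comp
      Primrec.fst))
  have hw : Primrec fun p : HRGrammar × List K =>
      (vertexList (terminalList p.1.stage₁)).map (weightList p.1.stage₃ p.2) :=
    Primrec.list_map
      (primrec_vertexList.comp (primrec_terminalList.comp
        (primrec_stage₁.comp Primrec.fst)))
      (primrec_weightList.comp
        (((primrec_stage₃.comp (Primrec.fst.comp Primrec.fst)).pair
          (Primrec.snd.comp Primrec.fst)).pair Primrec.snd)).to₂
  exact (hG.computablePred.and ((hmem.forall_mem_list.comp Computable.snd).and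
    (hsum.forall_mem_list.comp hw.to_comp))).of_eq fun p => (isPHRInstance_iff val p.1 p.2).symm

end HRGrammar

/-! ### Weights written as fractions -/

theorem fractionValue_mem_Icc (q : ℕ × ℕ) :
    fractionValue q ∈ Set.Icc (0 : ℝ) 1 ↔ q.1 ≤ q.2 + 1 := by
  have h : (0 : ℝ) < q.2 + 1 := by positivity
  rw [fractionValue, Set.mem_Icc, div_le_one h]
  constructor
  · rintro ⟨-, h'⟩
    exact_mod_cast h'
  · intro h'
    exact ⟨by positivity, by exact_mod_cast h'⟩

/-- Numerator and denominator of `∑ n m / (d + 1)`. -/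
def fractionSum (l : List (ℕ × ℕ × ℕ)) : ℕ × ℕ :=
  l.foldr (fun t s => (t.1 * t.2.1 * s.2 + s.1 * (t.2.2 + 1), s.2 * (t.2.2 + 1))) (0, 1)

theorem primrec_fractionSum : Primrec fractionSum := by
  have ht : Primrec fun p : List (ℕ × ℕ × ℕ) × (ℕ × ℕ × ℕ) × ℕ × ℕ => p.2.1 :=
    Primrec.fst.comp Primrec.snd
  have hs : Primrec fun p : List (ℕ × ℕ × ℕ) × (ℕ × ℕ × ℕ) × ℕ × ℕ => p.2.2 :=
    Primrec.snd.comp Primrec.snd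
  have hd : Primrec fun p : List (ℕ × ℕ × ℕ) × (ℕ × ℕ × ℕ) × ℕ × ℕ => p.2.1.2.2 + 1 :=
    Primrec.succ.comp (Primrec.snd.comp (Primrec.snd.comp ht))
  exact Primrec.list_foldr Primrec.id (Primrec.const (0, 1))
    ((Primrec.nat_add.comp
      (Primrec.nat_mul.comp
        (Primrec.nat_mul.comp (Primrec.fst.comp ht) (Primrec.fst.comp (Primrec.snd.comp ht)))
        (Primrec.snd.comp hs))
      (Primrec.nat_mul.comp (Primrec.fst.comp hs) hd)).pair
    (Primrec.nat_mul.comp (Primrec.snd.comp hs) hd)).to₂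

/-- Because the unreduced denominator is positive, the sum equals `1` exactly when numerator and
denominator coincide, a question about natural numbers. -/
theorem sum_eq_fractionSum (l : List (ℕ × ℕ × ℕ)) : 0 < (fractionSum l).2 ∧
    (l.map fun t => (t.1 : ℝ) * fractionValue t.2).sum =
      ((fractionSum l).1 : ℝ) / ((fractionSum l).2 : ℝ) := by
  induction l with
  | nil => simp [fractionSum]
  | cons t l ih =>
    obtain ⟨h1, h2⟩ := ih
    have e : fractionSum (t :: l) =
        (t.1 * t.2.1 * (fractionSum l).2 + (fractionSum l).1 * (t.2.2 + 1),
          (fractionSum l).2 * (t.2.2 + 1)) := rfl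
    refine ⟨by rw [e]; positivity, ?_⟩
    have h1' : ((fractionSum l).2 : ℝ) ≠ 0 := by positivity
    have h3 : (t.2.2 : ℝ) + 1 ≠ 0 := by positivity
    rw [List.map_cons, List.sum_cons, h2, e, fractionValue]
    push_cast
    field_simp

theorem computablePred_fractionValue_mem :
    ComputablePred fun q : ℕ × ℕ => fractionValue q ∈ Set.Icc (0 : ℝ) 1 :=
  ((Primrec.nat_le.comp Primrec.fst (Primrec.succ.comp Primrec.snd)).of_eq
    fun q => (fractionValue_mem_Icc q).symm).computablePred

theorem computablePred_fractionValue_sum :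
    ComputablePred fun l : List (ℕ × ℕ × ℕ) =>
      (l.map (fun t => (t.1 : ℝ) * fractionValue t.2)).sum = 1 :=
  ((Primrec.eq.comp (Primrec.fst.comp primrec_fractionSum)
    (Primrec.snd.comp primrec_fractionSum)).of_eq fun l => by
      obtain ⟨h1, h2⟩ := sum_eq_fractionSum l
      rw [h2, div_eq_one_iff_eq (by positivity), Nat.cast_inj]).computablePred

theorem mainTheorem5 :
    ComputablePred (fun p : HRGrammar × List (ℕ × ℕ) => IsPHRInstance fractionValue p) ∧
    ∀ (K : Type) [Primcodable K] (val : K → ℝ),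
      ComputablePred (fun k : K => val k ∈ Set.Icc (0 : ℝ) 1) →
      ComputablePred (fun l : List (ℕ × K) =>
        (l.map (fun t => (t.1 : ℝ) * val t.2)).sum = 1) →
      ComputablePred (fun p : HRGrammar × List K => IsPHRInstance val p) :=
  ⟨HRGrammar.computablePred_isPHRInstance computablePred_fractionValue_mem
    computablePred_fractionValue_sum,
    fun _ _ _ hmem hsum => HRGrammar.computablePred_isPHRInstance hmem hsum⟩
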